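/- Let $c\in\mathbb{C}$ and let $f$ be a meromorphic function in the complex plane of finite order, i.e. $\limsup_{r\to\infty}\frac{\log^+ T(r,f)}{\log r}<\infty$, where $T(r,f)$ is the Nevanlinna characteristic. Assume that $f$ is not a non-constant rational function. A target $a$ is a point of the extended complex plane $\mathbb{C}\cup\{\infty\}$ or, more generally, a meromorphic function with period $c$ that is small compared to $f$, i.e. $T(r,a)=o(T(r,f))$ as $r\to\infty$ outside a set $E$ with $\int_E dr/r<\infty$. An $a$-point of $f$ is a pole of $f$ if $a=\infty$ and a zero of $f-a$ otherwise, with the corresponding multiplicity. We say that $a$ is an exceptional paired value of $f$ with the separation $c$ if, for all except at most finitely many $a$-points $z$ of $f$, the point $z+c$ is also an $a$-point of $f$, with the same or higher multiplicity. If $f$ has three distinct exceptional paired values with the separation $c$, then $f$ is periodic with period $c$, i.e. $f(z+c)\equiv f(z)$. -/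

import Mathlib

open Filter Asymptotics MeasureTheory

noncomputable section

namespace PairedValue

/-! Meromorphic functions on the plane are functions `f : ℂ → ℂ` with `Meromorphic f`; the value
of such a function at a single point carries no information, so identities between meromorphic
functions are stated away from a closed discrete set, that is, along `codiscrete ℂ`. -/

/-- The identity `f(z) ≡ g(z)` of meromorphic functions. -/
def MeroEq (f g : ℂ → ℂ) : Prop := f =ᶠ[codiscrete ℂ] g

/-- The meromorphic function `f` is periodic with period `c`: `f(z + c) ≡ f(z)`. -/
def IsPeriodic (f : ℂ → ℂ) (c : ℂ) : Prop := MeroEq (fun z ↦ f (z + c)) f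

/-- The meromorphic function `f` is constant. -/
def IsConst (f : ℂ → ℂ) : Prop := ∃ k : ℂ, MeroEq f (fun _ ↦ k)

/-- The meromorphic function `f` is a rational function. -/
def IsRational (f : ℂ → ℂ) : Prop :=
  ∃ p q : Polynomial ℂ, q ≠ 0 ∧ MeroEq f (fun z ↦ p.eval z / q.eval z)

/-- The Nevanlinna characteristic `T(r, f) = m(r, f) + N(r, f)`. -/
def T (f : ℂ → ℂ) (r : ℝ) : ℝ := ValueDistribution.characteristic f ⊤ r

/-- The order of growth `limsup_{r → ∞} log⁺ T(r, f) / log r` of `f`. -/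
def growthOrder (f : ℂ → ℂ) : EReal :=
  limsup (fun r : ℝ ↦ ((Real.posLog (T f r) / Real.log r : ℝ) : EReal)) atTop

/-- `f` has finite order of growth. -/
def HasFiniteOrder (f : ℂ → ℂ) : Prop := growthOrder f < ⊤

/-- `g` is small compared to `f`: `T(r, g) = o(T(r, f))` as `r → ∞` outside of a set `E` of finite
logarithmic measure `∫_E dr / r < ∞`. -/
def IsSmall (g f : ℂ → ℂ) : Prop :=
  ∃ E : Set ℝ, MeasurableSet E ∧ E ⊆ Set.Ici 1 ∧ ∫⁻ r in E, ENNReal.ofReal r⁻¹ < ⊤ ∧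
    (T g) =o[atTop ⊓ 𝓟 Eᶜ] (T f)

/-- A target: the value `∞`, or a (possibly constant) function. -/
inductive Target
  | infty : Target
  | fn (g : ℂ → ℂ) : Target

/-- The finite constant value `k`, as a target. -/
def Target.const (k : ℂ) : Target := .fn (fun _ ↦ k)

/-- Two targets are the same. -/
def Target.Same : Target → Target → Prop
  | .infty, .infty => True
  | .fn g, .fn h => MeroEq g h
  | _, _ => False

/-- The targets `a` allowed for `f` and the separation `c`: the points of the extended complex
plane, and the meromorphic functions with period `c` that are small compared to `f`. -/
def Target.IsAdmissible (f : ℂ → ℂ) (c : ℂ) : Target → Prop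
  | .infty => True
  | .fn g => (∃ k : ℂ, g = fun _ ↦ k) ∨ (Meromorphic g ∧ IsPeriodic g c ∧ IsSmall g f)

open Classical in
/-- The multiplicity of `z` as an `a`-point of `f`: the order of the pole of `f` at `z` for
`a = ∞`, and the order of the zero of `f - a` at `z` otherwise (`⊤` if `f ≡ a`). It is `0` if and
only if `z` is not an `a`-point of `f`. -/
def pointMultiplicity (f : ℂ → ℂ) : Target → ℂ → ℕ∞
  | .infty, z => ((-(meromorphicOrderAt f z).untop₀).toNat : ℕ∞)
  | .fn g, z =>
      if meromorphicOrderAt (fun w ↦ f w - g w) z = ⊤ then ⊤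
      else ((meromorphicOrderAt (fun w ↦ f w - g w) z).untop₀.toNat : ℕ∞)

/-- `a` is an exceptional paired value of `f` with the separation `c`: all except at most finitely
many `a`-points `z` of `f` are such that `z + c` is an `a`-point of `f` with the same or higher
multiplicity. (As `a` has period `c`, the `a`-points at `z + c` are those where
`f(z + c) = a(z)`.) -/
def IsExceptionalPaired (f : ℂ → ℂ) (c : ℂ) (a : Target) : Prop :=
  {z : ℂ | 0 < pointMultiplicity f a z ∧
    ¬ pointMultiplicity f a z ≤ pointMultiplicity f a (z + c)}.Finite

end PairedValue

end

noncomputable section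

namespace PairedValue

open Real Metric Topology ValueDistribution MeromorphicOn InnerProductSpace

/-! Suppose `f` is neither rational nor periodic, and write Δf(z) = f(z + c) - f(z), which is not
identically zero. A finite target `a` has period `c`, so Δf = Δ(f - a). Hence, with finitely many
exceptions, Δf vanishes at a zero of `f - a` to at least the same order
(`IsExceptionalPaired.divisor_sub_le`). Moreover m(r, Δf/(f - a)) is negligible by the difference
analogue of the lemma on the logarithmic derivative (`exists_proximity_shift_div_le`).

Let W be Δf divided by the product of the `f - a` over the two or three finite targets. By partial
fractions, W and W·f have negligible proximity functions. As Δf cancels the zeros of the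
denominator, the divisor of W is at least 2P - P_c up to a negligible part, where P and P_c are the
pole divisors of f and f(· + c). Jensen's formula for W then gives 2N(r, f) + m(r, f) ≤ N(r, f(· +
c)) + o(T(r, f)). Since N(r, f(· + c)) is nearly N(r, f) (`exists_logCounting_shift_le`), T(r, f) is
bounded by half of itself, which is absurd (`GoodRadii.false_of_divisor_le`).

The estimates are compared along radii r_n and R_n ≥ 8 r_n, outside the exceptional sets, with
T(R_n, f) ≤ C T(r_n, f); finite order provides them (`exists_radii`). Errors O(log r) are negligible
because `f` is not rational (`log_isLittleO_T`). -/

/-! ### Circle averages of linear factors and elementary logarithm bounds -/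

lemma log_radius_add_posLog {r x : ℝ} (hr : 0 < r) (hx : 0 ≤ x) :
    log r + log⁺ (r⁻¹ * x) = log (max r x) := by
  rw [posLog_eq_log_max_one (by positivity), ← log_mul hr.ne' (by positivity),
    mul_max_of_nonneg _ _ hr.le, mul_inv_cancel_left₀ hr.ne', mul_one]

lemma circleAverage_log_norm_inv_mul_sub {r A : ℝ} (hr : 0 < r) (hA : 0 < A) (b : ℂ) :
    circleAverage (fun z ↦ log ‖(A : ℂ)⁻¹ * (z - b)‖) 0 r = log (max r ‖b‖) - log A := by
  have h : circleAverage (fun z ↦ log ‖(A : ℂ)⁻¹ * (z - b)‖) 0 r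
      = circleAverage (fun z ↦ log ‖z - b‖ - log A) 0 r := by
    apply circleAverage_congr_codiscreteWithin _ hr.ne'
    have : {b}ᶜ ∈ codiscreteWithin (sphere (0 : ℂ) |r|) := by simp
    filter_upwards [this] with z hz
    rw [norm_mul, log_mul (by simpa using hA.ne') (by simpa [sub_eq_zero] using hz)]
    simp [abs_of_pos hA]
    ring
  rw [h, circleAverage_fun_sub (circleIntegrable_log_norm_sub_const _)
    (circleIntegrable_const _ _ _), circleAverage_const,
    circleAverage_log_norm_sub_const_eq_log_radius_add_posLog hr.ne']
  simp [log_radius_add_posLog hr (norm_nonneg b)]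

/-- The proximity function of `A / (z - a)` is small, uniformly in `a`. -/
lemma proximity_div_sub_const_le {r A : ℝ} (hr : 0 < r) (hA : 0 < A) (a : ℂ) :
    proximity (fun z : ℂ ↦ (A : ℂ) / (z - a)) ⊤ r ≤ A / r := by
  set g : ℂ → ℂ := fun z ↦ (A : ℂ)⁻¹ * (z - a) with hg
  have hgm : Meromorphic g := by intro z; fun_prop
  have hinv : (fun z : ℂ ↦ (A : ℂ) / (z - a)) = g⁻¹ := by
    ext z; simp [hg, div_eq_mul_inv, mul_comm]
  have h1 := congrFun (proximity_sub_proximity_inv_eq_circleAverage hgm) r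
  rw [Pi.sub_apply, circleAverage_log_norm_inv_mul_sub hr hA] at h1
  have hA' : (A : ℂ) ≠ 0 := by exact_mod_cast hA.ne'
  have h2 : proximity g ⊤ r ≤ log (max r ‖a‖ + A) - log A := by
    -- Cartan's formula: the proximity of `g` is the mean over unit `e` of the circle averages of
    -- `log ‖g - e‖`. As `g - e` is again linear, with zero at `a + A * e`, each average is
    -- explicit.
    rw [← circleAverage_circleAverage_eq_proximity_top hgm]
    refine circleAverage_mono_on_of_le_circle (circleIntegrable_circleAverage_log_norm_sub hgm) ?_
    intro e he
    have he1 : ‖e‖ = 1 := by simpa using he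
    have : (fun z ↦ log ‖g z - e‖) = fun z ↦ log ‖(A : ℂ)⁻¹ * (z - (a + A * e))‖ := by
      ext z; congr 2; simp only [hg]; field_simp; ring
    rw [this, circleAverage_log_norm_inv_mul_sub hr hA]
    gcongr
    refine max_le (by linarith [le_max_left r ‖a‖]) ?_
    calc ‖a + A * e‖ ≤ ‖a‖ + ‖A * e‖ := norm_add_le _ _
      _ = ‖a‖ + A := by simp [he1, abs_of_pos hA]
      _ ≤ _ := by gcongr; exact le_max_right _ _
  have hM : 0 < max r ‖a‖ := lt_max_of_lt_left hr
  have h3 : log (max r ‖a‖ + A) - log (max r ‖a‖) ≤ A / r := by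
    rw [← log_div (by positivity) hM.ne']
    calc log ((max r ‖a‖ + A) / max r ‖a‖) ≤ (max r ‖a‖ + A) / max r ‖a‖ - 1 :=
          log_le_sub_one_of_pos (by positivity)
      _ = A / max r ‖a‖ := by field_simp; ring
      _ ≤ A / r := by gcongr; exact le_max_left _ _
  rw [hinv]; linarith

/-- Split at the scale `A`: for `x ≥ A` the ratio `k / x` is at most `k / A`, and for `x < A` the
factor `A / x` is split off. The free scale later becomes `√r`, large against `k` and small against
`r`. -/
lemma log_one_add_div_le {k x A : ℝ} (hk : 0 ≤ k) (hx : 0 ≤ x) (hA : 0 < A) :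
    log (1 + k / x) ≤ 2 * k / A + log⁺ (A / x) := by
  have hlog : ∀ y : ℝ, 0 ≤ y → log (1 + y) ≤ y := fun y hy ↦ by
    linarith [log_le_sub_one_of_pos (by positivity : 0 < 1 + y)]
  have hkA : 2 * k / A = k / A + k / A := by ring
  rcases hx.eq_or_lt with rfl | hx
  · simp; positivity
  rcases le_or_gt A x with h | h
  · calc log (1 + k / x) ≤ k / x := hlog _ (by positivity)
      _ ≤ k / A := by gcongr
      _ ≤ _ := by have : 0 ≤ k / A := by positivity
                  linarith [posLog_nonneg (x := A / x)]
  · have h1 : log (1 + k / x) ≤ log ((1 + k / A) * (A / x)) := by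
      apply log_le_log (by positivity)
      have : (1 + k / A) * (A / x) = A / x + k / x := by field_simp
      rw [this]; gcongr
      rw [one_le_div hx]; exact h.le
    rw [log_mul (by positivity) (by positivity)] at h1
    have h2 : log (A / x) ≤ log⁺ (A / x) := by simp [posLog_apply]
    have := hlog (k / A) (by positivity)
    have : 0 ≤ k / A := by positivity
    linarith

/-! ### Harmonic functions, discrete exceptions and local factorization -/

/-- Gradient estimate for harmonic functions. -/
lemma abs_sub_le_of_harmonicOnNhd {u : ℂ → ℝ} {R : ℝ} (hR : 0 < R)
    (hu : HarmonicOnNhd u (closedBall 0 R)) {w w' : ℂ} (hw : ‖w‖ ≤ R / 2) (hw' : ‖w'‖ ≤ R / 2) :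
    |u w - u w'| ≤ 8 * ‖w - w'‖ / R * circleAverage (fun z ↦ |u z|) 0 R := by
  have mem : ∀ {v : ℂ}, ‖v‖ ≤ R / 2 → v ∈ ball (0 : ℂ) R := fun {v} hv ↦ by
    simp; linarith
  have hui : ContinuousOn u (sphere 0 R) := fun x hx ↦
    (hu x (sphere_subset_closedBall hx)).1.continuousAt.continuousWithinAt
  have hci : ∀ {v : ℂ}, ‖v‖ ≤ R / 2 →
      CircleIntegrable ((Complex.re ∘ herglotzRieszKernel 0 v) • u) 0 R := fun {v} hv ↦ by
    apply ContinuousOn.circleIntegrable hR.le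
    apply ContinuousOn.smul _ hui
    have := continuousOn_herglotzRieszKernel_sphere (mem hv)
    rw [abs_of_pos hR] at this
    exact Complex.continuous_re.comp_continuousOn this
  -- Poisson's formula at both points. The difference of the kernels contains the factor `w - w'`,
  -- and both denominators are at least `R / 2`, whence the constant 2R/(R/2)² = 8/R.
  rw [← hu.circleAverage_re_herglotzRieszKernel_smul (mem hw),
    ← hu.circleAverage_re_herglotzRieszKernel_smul (mem hw'),
    ← circleAverage_sub (hci hw) (hci hw')]
  refine abs_circleAverage_le_circleAverage_abs.trans ?_
  rw [← smul_eq_mul, ← circleAverage_fun_smul]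
  apply circleAverage_mono
  · exact ((hci hw).sub (hci hw')).abs
  · apply ContinuousOn.circleIntegrable hR.le
    exact continuousOn_const.mul hui.abs
  intro z hz
  have hz : ‖z‖ = R := by simpa [abs_of_pos hR] using hz
  have hb : ∀ {v : ℂ}, ‖v‖ ≤ R / 2 → R / 2 ≤ ‖z - v‖ := fun {v} hv ↦ by
    linarith [norm_sub_norm_le z v]
  have hn : ∀ {v : ℂ}, ‖v‖ ≤ R / 2 → z - v ≠ 0 := fun {v} hv ↦ by
    rw [← norm_pos_iff]; linarith [hb hv]
  have key : herglotzRieszKernel 0 w z - herglotzRieszKernel 0 w' z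
      = 2 * z * (w - w') / ((z - w) * (z - w')) := by
    have h1 := hn hw
    have h2 := hn hw'
    simp only [herglotzRieszKernel_def, sub_zero]
    field_simp
    ring
  simp only [Pi.abs_apply, Pi.sub_apply, smul_eq_mul, Pi.mul_apply, Function.comp_apply]
  rw [← sub_mul, ← Complex.sub_re, key, abs_mul]
  gcongr
  refine (Complex.abs_re_le_norm _).trans ?_
  rw [norm_div, norm_mul, norm_mul, norm_mul, hz]
  have : 0 ≤ ‖w - w'‖ := norm_nonneg _
  calc ‖(2 : ℂ)‖ * R * ‖w - w'‖ / (‖z - w‖ * ‖z - w'‖)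
      ≤ ‖(2 : ℂ)‖ * R * ‖w - w'‖ / (R / 2 * (R / 2)) := by
        gcongr
        · exact hb hw
        · exact hb hw'
    _ = 8 * ‖w - w'‖ / R := by simp; field_simp; ring

lemma circleAverage_mono_codiscreteWithin {f g : ℂ → ℝ} {r : ℝ} (hr : r ≠ 0)
    (hf : CircleIntegrable f 0 r) (hg : CircleIntegrable g 0 r)
    (h : ∀ᶠ z in codiscreteWithin (sphere (0 : ℂ) |r|), f z ≤ g z) :
    circleAverage f 0 r ≤ circleAverage g 0 r := by
  have e : f =ᶠ[codiscreteWithin (sphere (0 : ℂ) |r|)] fun z ↦ min (f z) (g z) := by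
    filter_upwards [h] with z hz
    simp [hz]
  rw [circleAverage_congr_codiscreteWithin e hr]
  exact circleAverage_mono (hf.congr_codiscreteWithin e) hg fun z _ ↦ min_le_right _ _

lemma eventually_codiscreteWithin_of_nhdsNE {p : ℂ → Prop} {U : Set ℂ}
    (h : ∀ z ∈ U, ∀ᶠ w in 𝓝[≠] z, p w) : ∀ᶠ z in codiscreteWithin U, p z := by
  rw [Filter.Eventually, mem_codiscreteWithin_iff_forall_mem_nhdsNE]
  intro z hz
  filter_upwards [h z hz] with w hw
  exact Or.inl hw

lemma eventually_nhdsNE_comp_add {p : ℂ → Prop} {z c : ℂ} (h : ∀ᶠ w in 𝓝[≠] (z + c), p w) :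
    ∀ᶠ w in 𝓝[≠] z, p (w + c) := by
  have : Tendsto (fun w ↦ w + c) (𝓝[≠] z) (𝓝[≠] (z + c)) := by
    apply tendsto_nhdsWithin_of_tendsto_nhds_of_eventually_within
    · exact ((continuous_add_const c).tendsto z).mono_left nhdsWithin_le_nhds
    · filter_upwards [self_mem_nhdsWithin] with w hw
      simpa using hw
  exact this.eventually h

/-- A point with `‖a‖ ≤ R` contributes at least log(2R) - log R = log 2 to the counting function at
`2 * R`. For `a = 0` the convention `log 0 = 0` gives the correct contribution log(2R). -/
lemma sum_mul_log_two_le_logCounting {D : Function.locallyFinsupp ℂ ℤ} (hD : 0 ≤ D) {R : ℝ}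
    (hR : 1 ≤ R) (s : Finset ℂ) (hs : ∀ a ∈ s, ‖a‖ ≤ R) :
    (∑ a ∈ s, (D a : ℝ)) * log 2 ≤ Function.locallyFinsuppWithin.logCounting D (2 * R) := by
  classical
  set D' : Function.locallyFinsupp ℂ ℤ :=
    ∑ a ∈ s, Function.locallyFinsuppWithin.single a (D a) with hD'
  have hle : D' ≤ D := by
    intro w
    have : D' w = if w ∈ s then D w else 0 := by
      simp only [hD', Function.locallyFinsuppWithin.coe_sum, Finset.sum_apply,
        Function.locallyFinsuppWithin.single_apply]
      simp
    rw [this]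
    split_ifs
    · exact le_rfl
    · exact hD w
  refine le_trans ?_ (Function.locallyFinsuppWithin.logCounting_le hle (by linarith))
  rw [hD', map_sum, Finset.sum_apply, Finset.sum_mul]
  apply Finset.sum_le_sum
  intro a ha
  have haR := hs a ha
  rw [Function.locallyFinsuppWithin.logCounting_single_eq_log_sub_const (by linarith)]
  have h0 : (0 : ℝ) ≤ D a := by exact_mod_cast hD a
  gcongr
  rw [log_mul (by norm_num) (by linarith)]
  have : log ‖a‖ ≤ log R := by
    rcases (norm_nonneg a).eq_or_lt with h | h
    · rw [← h, log_zero]; exact log_nonneg hR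
    · exact log_le_log h haR
  linarith

/-- Local factorization of a meromorphic function, in terms of the logarithm of its modulus. -/
lemma exists_harmonic_log_norm_eq {F : ℂ → ℂ} (hF : Meromorphic F)
    (hF' : ∀ z, meromorphicOrderAt F z ≠ ⊤) (R : ℝ) :
    ∃ (s : Finset ℂ) (u : ℂ → ℝ), (∀ a ∈ s, ‖a‖ ≤ |R|) ∧ HarmonicOnNhd u (closedBall 0 |R|) ∧
      ∀ᶠ z in codiscreteWithin (closedBall (0 : ℂ) |R|),
        log ‖F z‖ = ∑ a ∈ s, (divisor F Set.univ a : ℝ) * log ‖z - a‖ + u z := by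
  have hfin := (divisor F (closedBall 0 |R|)).finiteSupport (isCompact_closedBall 0 |R|)
  obtain ⟨g, hg, hg0, hfg⟩ := (hF.meromorphicOn (s := closedBall 0 |R|)).extract_zeros_poles
    (fun u ↦ hF' u) hfin
  have hlog := extract_zeros_poles_log hg0 hfg
  have hmem : ∀ a ∈ hfin.toFinset, a ∈ closedBall (0 : ℂ) |R| := fun a ha ↦
    (divisor F (closedBall 0 |R|)).supportWithinDomain (by simpa using ha)
  refine ⟨hfin.toFinset, fun z ↦ log ‖g z‖, fun a ha ↦ by simpa using hmem a ha,
    fun x hx ↦ (hg x hx).harmonicAt_log_norm (hg0 ⟨x, hx⟩), ?_⟩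
  filter_upwards [hlog] with z hz
  rw [hz, Pi.add_apply, finsum_eq_sum_of_support_subset (s := hfin.toFinset), Finset.sum_apply]
  · congr 1
    apply Finset.sum_congr rfl
    intro a ha
    rw [divisor_apply hF.meromorphicOn (hmem a ha), divisor_apply hF.meromorphicOn (Set.mem_univ a)]
  · intro a ha
    simp only [Set.Finite.coe_toFinset, Function.mem_support] at ha ⊢
    intro h
    apply ha
    rw [h]; simp; rfl

lemma abs_log_sub_log_le {x y k : ℝ} (hx : 0 < x) (hy : 0 < y) (h : |x - y| ≤ k) :
    |log x - log y| ≤ log (1 + k / x) + log (1 + k / y) := by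
  have hk : 0 ≤ k := (abs_nonneg _).trans h
  rw [abs_le] at h
  have aux : ∀ {p q : ℝ}, 0 < p → 0 < q → p - q ≤ k →
      log p - log q ≤ log (1 + k / q) := fun {p q} hp hq hpq ↦ by
    rw [← log_div hp.ne' hq.ne']
    apply log_le_log (by positivity)
    rw [div_le_iff₀ hq]
    field_simp; linarith
  have h1 := aux hx hy (by linarith)
  have h2 := aux hy hx (by linarith)
  have p1 : 0 ≤ log (1 + k / x) := log_nonneg (by have : 0 ≤ k / x := by positivity
                                                  linarith)
  have p2 : 0 ≤ log (1 + k / y) := log_nonneg (by have : 0 ≤ k / y := by positivity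
                                                  linarith)
  rw [abs_le]; constructor <;> linarith

lemma circleIntegrable_finset_sum {ι : Type*} {s : Finset ι} {f : ι → ℂ → ℝ} {r : ℝ}
    (h : ∀ i ∈ s, CircleIntegrable (f i) 0 r) :
    CircleIntegrable (fun z ↦ ∑ i ∈ s, f i z) 0 r := by
  have := CircleIntegrable.sum s h
  convert this using 1
  ext z; simp

lemma circleAverage_abs_log_norm {F : ℂ → ℂ} (hF : Meromorphic F) (R : ℝ) :
    circleAverage (fun z ↦ |log ‖F z‖|) 0 R = proximity F ⊤ R + proximity F⁻¹ ⊤ R := by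
  have e : (fun z ↦ |log ‖F z‖|) = fun z ↦ log⁺ ‖F z‖ + log⁺ ‖F⁻¹ z‖ := by
    ext z
    simp only [Pi.inv_apply, norm_inv, posLog_apply, log_inv]
    rcases le_total 0 (log ‖F z‖) with h | h
    · simp [h, abs_of_nonneg]
    · simp [h, abs_of_nonpos]
  rw [e, circleAverage_fun_add (MeromorphicOn.circleIntegrable_posLog_norm fun _ _ ↦ hF _)
    (MeromorphicOn.circleIntegrable_posLog_norm fun _ _ ↦ hF.inv _), proximity_top, proximity_top]

/-- The mean of `|u|` over a circle, for `log |F| = ∑ d a * log |z - a| + u`. -/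
lemma circleAverage_abs_le_of_log_norm_eq {F : ℂ → ℂ} (hF : Meromorphic F) {R n : ℝ} (hR1 : 1 ≤ R)
    {s : Finset ℂ} (hs : ∀ a ∈ s, ‖a‖ ≤ R) {d : ℂ → ℝ} (hsn : ∑ a ∈ s, |d a| ≤ n) {u : ℂ → ℝ}
    (huc : ContinuousOn u (sphere 0 R))
    (hlog : ∀ᶠ z in codiscreteWithin (sphere (0 : ℂ) |R|),
      log ‖F z‖ = ∑ a ∈ s, d a * log ‖z - a‖ + u z) :
    circleAverage (fun z ↦ |u z|) 0 R ≤
      circleAverage (fun z ↦ |log ‖F z‖|) 0 R + n * (2 * log (2 * R)) := by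
  have hR : 0 < R := by linarith
  have hn0 : 0 ≤ n := (Finset.sum_nonneg fun _ _ ↦ abs_nonneg _).trans hsn
  have hlogF : CircleIntegrable (fun z ↦ log ‖F z‖) 0 R :=
    MeromorphicOn.circleIntegrable_log_norm fun _ _ ↦ hF _
  -- Since `‖z - a‖ ≤ 2 * R` on the circle, `2 * log (2 * R) - log ‖z - a‖` dominates `|log ‖z -
  -- a‖|`, and its circle average is explicit.
  have hi : ∀ a ∈ s, CircleIntegrable (fun z ↦ |d a| * (2 * log (2 * R) - log ‖z - a‖)) 0 R :=
    fun a _ ↦ ((circleIntegrable_const _ _ _).sub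
      (circleIntegrable_log_norm_sub_const R)).const_mul _
  have hS : circleAverage (fun z ↦ ∑ a ∈ s, |d a| * (2 * log (2 * R) - log ‖z - a‖)) 0 R
      ≤ n * (2 * log (2 * R)) := by
    rw [circleAverage_fun_sum hi]
    calc ∑ a ∈ s, circleAverage (fun z ↦ |d a| * (2 * log (2 * R) - log ‖z - a‖)) 0 R
        = ∑ a ∈ s, |d a| * (2 * log (2 * R) - log R) := by
          apply Finset.sum_congr rfl
          intro a ha
          simp_rw [← smul_eq_mul]
          rw [circleAverage_fun_smul, circleAverage_fun_sub (circleIntegrable_const _ _ _)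
            (circleIntegrable_log_norm_sub_const R), circleAverage_const,
            circleAverage_log_norm_sub_const_of_mem_closedBall
            (by simpa [abs_of_pos hR] using hs a ha)]
      _ = (∑ a ∈ s, |d a|) * (2 * log (2 * R) - log R) := by rw [Finset.sum_mul]
      _ ≤ n * (2 * log (2 * R) - log R) := by
          gcongr
          have := log_nonneg hR1
          have : log R ≤ log (2 * R) := log_le_log hR (by linarith)
          linarith
      _ ≤ _ := by
          gcongr
          linarith [log_nonneg hR1]
  refine le_trans ?_ (add_le_add_right hS _)
  rw [← circleAverage_fun_add (f₁ := fun z ↦ |log ‖F z‖|) hlogF.abs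
    (circleIntegrable_finset_sum hi)]
  apply circleAverage_mono_codiscreteWithin hR.ne'
  · exact ContinuousOn.circleIntegrable hR.le huc.abs
  · exact hlogF.abs.add (circleIntegrable_finset_sum hi)
  filter_upwards [hlog, self_mem_codiscreteWithin _] with z hz hzm
  have hzR : ‖z‖ = R := by simpa [abs_of_pos hR] using hzm
  have e : u z = log ‖F z‖ - ∑ a ∈ s, d a * log ‖z - a‖ := by rw [hz]; ring
  rw [e]
  refine (abs_sub _ _).trans ?_
  gcongr
  refine (Finset.abs_sum_le_sum_abs _ _).trans ?_
  apply Finset.sum_le_sum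
  intro a ha
  rw [abs_mul]
  gcongr
  have hza : ‖z - a‖ ≤ 2 * R := (norm_sub_le z a).trans (by linarith [hs a ha])
  have h2R : 0 ≤ log (2 * R) := log_nonneg (by linarith)
  have : log ‖z - a‖ ≤ log (2 * R) := by
    rcases (norm_nonneg (z - a)).eq_or_lt with h | h
    · rwa [← h, log_zero]
    · exact log_le_log h hza
  rw [abs_le]; constructor <;> linarith

/-! ### The difference analogue of the lemma on the logarithmic derivative -/

/-- Write log|F| = ∑ d_a log|z - a| + u with `u` harmonic on the disc of radius `R`, and subtract
the values at `z` from those at `z + c`. The gradient estimate controls the increment of `u`. Each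
increment of log|z - a| is bounded through the scale `A`, with a mean that does not depend on `a`;
`n` bounds the number of zeros and poles involved, with multiplicity. -/
lemma proximity_shift_div_le_aux {F : ℂ → ℂ} (hF : Meromorphic F)
    (hF' : ∀ z, meromorphicOrderAt F z ≠ ⊤) {r R A : ℝ} (hr : 0 < r) (hR1 : 1 ≤ R) (hA : 0 < A)
    (c : ℂ) (hrR : 2 * (r + ‖c‖) ≤ R) {n : ℝ}
    (hn : ∀ s : Finset ℂ, (∀ a ∈ s, ‖a‖ ≤ R) → ∑ a ∈ s, |(divisor F Set.univ a : ℝ)| ≤ n) :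
    proximity (fun z ↦ F (z + c) / F z) ⊤ r ≤
      n * (4 * ‖c‖ / A + 2 * (A / r)) +
        8 * ‖c‖ / R * (circleAverage (fun z ↦ |log ‖F z‖|) 0 R + n * (2 * log (2 * R))) := by
  have hR : 0 < R := by linarith
  have hc := norm_nonneg c
  have hn0 : 0 ≤ n := by simpa using hn ∅ (by simp)
  obtain ⟨s, u, hs, hu, hlog⟩ := exists_harmonic_log_norm_eq hF hF' R
  rw [abs_of_pos hR] at hs hu hlog
  set d : ℂ → ℝ := fun a ↦ (divisor F Set.univ a : ℝ) with hd
  have hsn : ∑ a ∈ s, |d a| ≤ n := hn s hs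
  have huc : ContinuousOn u (sphere 0 R) := fun x hx ↦
    (hu x (sphere_subset_closedBall hx)).1.continuousAt.continuousWithinAt
  have hU : circleAverage (fun z ↦ |u z|) 0 R ≤
      circleAverage (fun z ↦ |log ‖F z‖|) 0 R + n * (2 * log (2 * R)) := by
    apply circleAverage_abs_le_of_log_norm_eq hF hR1 hs hsn huc
    have hsub : sphere (0 : ℂ) |R| ⊆ closedBall 0 R := by
      rw [abs_of_pos hR]; exact sphere_subset_closedBall
    exact codiscreteWithin_mono hsub hlog
  -- the main estimate
  rw [proximity_top]
  have hFc : Meromorphic fun z ↦ F (z + c) := by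
    simpa using hF
  set P : ℂ → ℂ → ℝ := fun a z ↦ 4 * ‖c‖ / A + (log⁺ ‖(A : ℂ) / (z - a)‖
    + log⁺ ‖(A : ℂ) / (z - (a - c))‖) with hP
  have hPm : ∀ b : ℂ, CircleIntegrable (fun z ↦ log⁺ ‖(A : ℂ) / (z - b)‖) 0 r := fun b ↦
    MeromorphicOn.circleIntegrable_posLog_norm fun z _ ↦ by fun_prop
  have hPi : ∀ a ∈ s, CircleIntegrable (fun z ↦ |d a| * P a z) 0 r := fun a _ ↦
    ((circleIntegrable_const _ _ _).add ((hPm _).add (hPm _))).const_mul _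
  have hPa : ∀ a, circleAverage (P a) 0 r ≤ 4 * ‖c‖ / A + 2 * (A / r) := fun a ↦ by
    have h1 := proximity_div_sub_const_le hr hA a
    have h2 := proximity_div_sub_const_le hr hA (a - c)
    rw [proximity_top] at h1 h2
    simp only [hP]
    rw [circleAverage_fun_add (f₂ := fun z ↦ log⁺ ‖(A : ℂ) / (z - a)‖
      + log⁺ ‖(A : ℂ) / (z - (a - c))‖) (circleIntegrable_const _ _ _) ((hPm _).add (hPm _)),
      circleAverage_const, circleAverage_fun_add (hPm _) (hPm _)]
    linarith
  set K := 8 * ‖c‖ / R * circleAverage (fun z ↦ |u z|) 0 R with hK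
  have step : circleAverage (fun z ↦ log⁺ ‖F (z + c) / F z‖) 0 r ≤
      circleAverage (fun z ↦ (∑ a ∈ s, |d a| * P a z) + K) 0 r := by
    apply circleAverage_mono_codiscreteWithin hr.ne'
    · exact MeromorphicOn.circleIntegrable_posLog_norm fun z _ ↦ (hFc z).div (hF z)
    · exact (circleIntegrable_finset_sum hPi).add (circleIntegrable_const _ _ _)
    have hloc : ∀ v ∈ ball (0 : ℂ) R, ∀ᶠ w in 𝓝[≠] v,
        log ‖F w‖ = ∑ a ∈ s, d a * log ‖w - a‖ + u w := fun v hv ↦ by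
      have := mem_codiscreteWithin_iff_forall_mem_nhdsNE.1 hlog v (ball_subset_closedBall hv)
      filter_upwards [this, nhdsWithin_le_nhds (isOpen_ball.mem_nhds hv)] with w hw hwb
      exact hw.resolve_right (fun h ↦ h (ball_subset_closedBall hwb))
    have hne : ∀ v : ℂ, ∀ᶠ w in 𝓝[≠] v, (∀ a ∈ s, w ≠ a) ∧ F w ≠ 0 := fun v ↦ by
      apply Filter.Eventually.and
      · rw [Filter.eventually_all_finset]
        intro a _
        exact Filter.Eventually.filter_mono (nhdsNE_le_cofinite v) (by simp)
      · exact (meromorphicOrderAt_ne_top_iff_eventually_ne_zero (hF v)).1 (hF' v)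
    have hgen : ∀ᶠ z in codiscreteWithin (sphere (0 : ℂ) |r|),
        (log ‖F z‖ = ∑ a ∈ s, d a * log ‖z - a‖ + u z) ∧
        (log ‖F (z + c)‖ = ∑ a ∈ s, d a * log ‖z + c - a‖ + u (z + c)) ∧
        ((∀ a ∈ s, z ≠ a) ∧ F z ≠ 0) ∧ ((∀ a ∈ s, z + c ≠ a) ∧ F (z + c) ≠ 0) := by
      apply eventually_codiscreteWithin_of_nhdsNE
      intro z hz
      have hzr : ‖z‖ = r := by simpa [abs_of_pos hr] using hz
      have hz1 : z ∈ ball (0 : ℂ) R := by simp; linarith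
      have hz2 : z + c ∈ ball (0 : ℂ) R := by
        simp; linarith [norm_add_le z c]
      filter_upwards [hloc z hz1, eventually_nhdsNE_comp_add (hloc _ hz2), hne z,
        eventually_nhdsNE_comp_add (hne (z + c))] with w h1 h2 h3 h4
      exact ⟨h1, h2, h3, h4⟩
    filter_upwards [hgen, self_mem_codiscreteWithin _] with z ⟨h1, h2, ⟨h3, h3'⟩, h4, h4'⟩ hz
    have hzr : ‖z‖ = r := by simpa [abs_of_pos hr] using hz
    have hgrad : |u (z + c) - u z| ≤ K := by
      have := abs_sub_le_of_harmonicOnNhd hR hu (w := z + c) (w' := z)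
        (by linarith [norm_add_le z c]) (by linarith)
      simpa using this
    have hK0 : 0 ≤ K := (abs_nonneg _).trans hgrad
    have hP0 : ∀ a ∈ s, |log ‖z + c - a‖ - log ‖z - a‖| ≤ P a z := fun a ha ↦ by
      have p1 : 0 < ‖z + c - a‖ := by simpa [sub_eq_zero] using h4 a ha
      have p2 : 0 < ‖z - a‖ := by simpa [sub_eq_zero] using h3 a ha
      have hk : |‖z + c - a‖ - ‖z - a‖| ≤ ‖c‖ := by
        refine (abs_norm_sub_norm_le _ _).trans_eq ?_
        congr 1; ring
      refine (abs_log_sub_log_le p1 p2 hk).trans ?_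
      have q1 := log_one_add_div_le hc p1.le hA
      have q2 := log_one_add_div_le hc p2.le hA
      have e1 : z - (a - c) = z + c - a := by ring
      simp only [hP, e1, norm_div, Complex.norm_real, norm_eq_abs, abs_of_pos hA]
      have : 4 * ‖c‖ / A = 2 * ‖c‖ / A + 2 * ‖c‖ / A := by ring
      linarith
    have hsum0 : 0 ≤ ∑ a ∈ s, |d a| * P a z := Finset.sum_nonneg fun a ha ↦
      mul_nonneg (abs_nonneg _) ((abs_nonneg _).trans (hP0 a ha))
    rw [posLog_apply]
    apply max_le (by positivity)
    rw [norm_div, log_div (by simpa using h4') (by simpa using h3'), h1, h2]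
    calc ∑ a ∈ s, d a * log ‖z + c - a‖ + u (z + c) - (∑ a ∈ s, d a * log ‖z - a‖ + u z)
        = ∑ a ∈ s, d a * (log ‖z + c - a‖ - log ‖z - a‖) + (u (z + c) - u z) := by
          simp_rw [mul_sub]; rw [Finset.sum_sub_distrib]; ring
      _ ≤ ∑ a ∈ s, |d a| * P a z + K := by
          apply add_le_add _ ((le_abs_self _).trans hgrad)
          apply Finset.sum_le_sum
          intro a ha
          refine (le_abs_self _).trans ?_
          rw [abs_mul]
          gcongr
          exact hP0 a ha
  refine step.trans ?_
  rw [circleAverage_fun_add (circleIntegrable_finset_sum hPi) (circleIntegrable_const _ _ _),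
    circleAverage_const, circleAverage_fun_sum hPi]
  gcongr ?_ + ?_
  · calc ∑ a ∈ s, circleAverage (fun z ↦ |d a| * P a z) 0 r
        ≤ ∑ a ∈ s, |d a| * (4 * ‖c‖ / A + 2 * (A / r)) := by
          apply Finset.sum_le_sum
          intro a ha
          simp_rw [← smul_eq_mul]
          rw [circleAverage_fun_smul]
          simp only [smul_eq_mul]
          gcongr
          exact hPa a
      _ = (∑ a ∈ s, |d a|) * (4 * ‖c‖ / A + 2 * (A / r)) := by rw [Finset.sum_mul]
      _ ≤ n * (4 * ‖c‖ / A + 2 * (A / r)) := by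
          gcongr
  · gcongr

/-- Difference analogue of the lemma on the logarithmic derivative. -/
lemma exists_proximity_shift_div_le {F : ℂ → ℂ} (hF : Meromorphic F)
    (hF' : ∀ z, meromorphicOrderAt F z ≠ ⊤) (c : ℂ) :
    ∃ δ : ℝ → ℝ, Tendsto δ atTop (𝓝 0) ∧ ∀ᶠ r in atTop, ∀ R, 8 * r ≤ R →
      proximity (fun z ↦ F (z + c) / F z) ⊤ r ≤ δ r * (T F R + 1) := by
  obtain ⟨C, hC⟩ : ∃ C : ℝ, ∀ r : ℝ, |characteristic F ⊤ r - characteristic F⁻¹ ⊤ r| ≤ C :=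
    ⟨_, fun r ↦ characteristic_sub_characteristic_inv_le hF (R := r)⟩
  have hC0 : 0 ≤ C := (abs_nonneg _).trans (hC 0)
  have hc := norm_nonneg c
  -- The coefficient of `X` in `proximity_shift_div_le_aux` for `A = √r`, radius `2 * (r + ‖c‖)` and
  -- `n = X / log 2`. The choice `A = √r` makes both `‖c‖ / A` and `A / r` of order r^(-1/2); the
  -- rest is O(log r / r).
  set δ₀ : ℝ → ℝ := fun r ↦ (1 / log 2) * (4 * ‖c‖ / √r + 2 * (√r / r)) +
    8 * ‖c‖ / (2 * (r + ‖c‖)) * (1 + 1 / log 2 * (2 * log (4 * (r + ‖c‖)))) with hδ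
  refine ⟨fun r ↦ (2 + C) * δ₀ r, ?_, ?_⟩
  · have hs : Tendsto (fun r : ℝ ↦ (√r)⁻¹) atTop (𝓝 0) :=
      tendsto_inv_atTop_zero.comp tendsto_sqrt_atTop
    have hy : Tendsto (fun r : ℝ ↦ 4 * (r + ‖c‖)) atTop atTop :=
      (tendsto_atTop_add_const_right _ _ tendsto_id).const_mul_atTop (by norm_num)
    have hl := isLittleO_log_id_atTop.tendsto_div_nhds_zero.comp hy
    have hi := tendsto_inv_atTop_zero.comp hy
    have := ((hs.const_mul (1 / log 2 * (4 * ‖c‖ + 2))).add ((hi.const_mul (16 * ‖c‖)).add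
      (hl.const_mul (16 * ‖c‖ * (2 / log 2))))).const_mul (2 + C)
    simp only [mul_zero, add_zero] at this
    refine this.congr' ?_
    filter_upwards [eventually_gt_atTop 0] with r hr
    have : 0 < r + ‖c‖ := by linarith
    simp only [hδ, sqrt_div_self, Function.comp_apply, id_eq]
    field_simp
    ring
  filter_upwards [eventually_ge_atTop 1, eventually_ge_atTop ‖c‖] with r hr1 hrc R hR
  -- From `‖c‖ ≤ r` follows `2 * R₀ ≤ 8 * r ≤ R`; the zeros and poles in the disc of radius `R₀` are
  -- counted by means of the radius `2 * R₀`.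
  set R₀ := 2 * (r + ‖c‖) with hR₀
  have hR₀1 : 1 ≤ R₀ := by linarith
  have h2R₀ : 2 * R₀ ≤ R := by linarith
  have hl2 : 0 < log 2 := log_pos (by norm_num)
  -- By monotonicity and the first main theorem, `X` bounds the sum of the characteristics of `F`
  -- and `F⁻¹` at every positive radius up to `R`.
  set X := 2 * T F R + C with hX
  have hmono : ∀ {ρ : ℝ}, 0 < ρ → ρ ≤ R →
      characteristic F ⊤ ρ + characteristic F⁻¹ ⊤ ρ ≤ X := fun {ρ} h0 h1 ↦ by
    have m1 : characteristic F ⊤ ρ ≤ T F R := characteristic_monotoneOn hF h0 (h0.trans_le h1) h1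
    have m2 := (abs_le.1 (hC ρ)).1
    linarith
  have hT0 : 0 ≤ T F R := characteristic_nonneg (by linarith)
  have hX0 : 0 ≤ X := by positivity
  have hn : ∀ s : Finset ℂ, (∀ a ∈ s, ‖a‖ ≤ R₀) →
      ∑ a ∈ s, |(divisor F Set.univ a : ℝ)| ≤ 1 / log 2 * X := fun s hs ↦ by
    have h1 := sum_mul_log_two_le_logCounting (D := (divisor F Set.univ)⁺ + (divisor F Set.univ)⁻)
      (add_nonneg (posPart_nonneg _) (negPart_nonneg _)) hR₀1 s hs
    have e : ∀ a, ((((divisor F Set.univ)⁺ + (divisor F Set.univ)⁻ :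
        Function.locallyFinsupp ℂ ℤ) a : ℤ) : ℝ) = |(divisor F Set.univ a : ℝ)| := fun a ↦ by
      rw [Function.locallyFinsuppWithin.coe_add, Pi.add_apply,
        Function.locallyFinsuppWithin.posPart_apply, Function.locallyFinsuppWithin.negPart_apply,
        posPart_add_negPart, Int.cast_abs]
    simp_rw [e] at h1
    rw [map_add, Pi.add_apply, ← logCounting_top, ← logCounting_zero, ← logCounting_inv] at h1
    have h2 := hmono (ρ := 2 * R₀) (by linarith) h2R₀
    have h3 := proximity_nonneg (f := F) (a := ⊤) (2 * R₀)
    have h4 := proximity_nonneg (f := F⁻¹) (a := ⊤) (2 * R₀)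
    simp only [characteristic, Pi.add_apply] at h2
    simp only [Pi.zero_apply] at h3 h4
    rw [one_div, inv_mul_eq_div, le_div_iff₀ hl2]
    linarith
  have hmain := proximity_shift_div_le_aux hF hF' (r := r) (R := R₀) (A := √r) (by linarith) hR₀1
    (by positivity) c le_rfl hn
  have hav : circleAverage (fun z ↦ |log ‖F z‖|) 0 R₀ ≤ X := by
    rw [circleAverage_abs_log_norm hF]
    have h2 := hmono (ρ := R₀) (by linarith) (by linarith)
    have h3 := logCounting_nonneg (f := F) (e := ⊤) hR₀1
    have h4 := logCounting_nonneg (f := F⁻¹) (e := ⊤) hR₀1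
    simp only [characteristic, Pi.add_apply] at h2
    linarith
  have h4R : 2 * R₀ = 4 * (r + ‖c‖) := by ring
  have hδ0 : 0 ≤ δ₀ r := by
    have : 0 ≤ log (4 * (r + ‖c‖)) := log_nonneg (by linarith)
    have : 0 ≤ r + ‖c‖ := by linarith
    simp only [hδ]
    positivity
  calc proximity (fun z ↦ F (z + c) / F z) ⊤ r
      ≤ 1 / log 2 * X * (4 * ‖c‖ / √r + 2 * (√r / r)) +
        8 * ‖c‖ / R₀ * (X + 1 / log 2 * X * (2 * log (2 * R₀))) := by
        refine hmain.trans ?_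
        gcongr
    _ = δ₀ r * X := by simp only [hδ, h4R, ← hR₀]; ring
    _ ≤ δ₀ r * ((2 + C) * (T F R + 1)) := by
        gcongr
        rw [hX]; nlinarith
    _ = _ := by ring

/-! ### Counting functions under a shift -/

/-- The contribution of a point `a` of multiplicity one to the logarithmic counting function. -/
def countingWeight (r : ℝ) (a : ℂ) : ℝ :=
  if a = 0 then log r else log⁺ (r * ‖a‖⁻¹)

/-- The index set may be larger than needed, since `log⁺` removes points outside the disc. Counting
functions at different radii can thus be compared term by term over one finite set. -/
lemma logCounting_eq_sum {D : Function.locallyFinsupp ℂ ℤ} {r : ℝ} (hr : 1 ≤ r) (s : Finset ℂ)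
    (hs : ∀ a, ‖a‖ ≤ r → D a ≠ 0 → a ∈ s) :
    Function.locallyFinsuppWithin.logCounting D r = ∑ a ∈ s, (D a : ℝ) * countingWeight r a := by
  have h0 : 0 < r := by linarith
  have habs : |r| = r := abs_of_pos h0
  have hsupp : ∀ a, Function.locallyFinsuppWithin.toClosedBall r D a ≠ 0 → a ∈ s := fun a ha ↦ by
    by_cases h : a ∈ closedBall (0 : ℂ) |r|
    · rw [Function.locallyFinsuppWithin.toClosedBall_eval_within _ h] at ha
      exact hs a (by simpa [habs] using h) ha
    · exact absurd (Function.locallyFinsuppWithin.apply_eq_zero_of_notMem _ h) ha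
  simp only [Function.locallyFinsuppWithin.logCounting, AddMonoidHom.coe_mk, ZeroHom.coe_mk]
  rw [finsum_eq_sum_of_support_subset (s := s)]
  · have hD0 : (D 0 : ℝ) * log r = ∑ a ∈ s, if a = 0 then (D 0 : ℝ) * log r else 0 := by
      rw [Finset.sum_ite_eq']
      split_ifs with h
      · rfl
      · have : D 0 = 0 := by
          by_contra h'
          exact h (hs 0 (by simpa using h0.le) h')
        simp [this]
    rw [hD0, ← Finset.sum_add_distrib]
    apply Finset.sum_congr rfl
    intro a _
    by_cases ha : a = 0
    · simp [ha, countingWeight]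
    simp only [countingWeight, ha, if_false, add_zero]
    have hn : 0 < ‖a‖ := norm_pos_iff.2 ha
    by_cases h : a ∈ closedBall (0 : ℂ) |r|
    · rw [Function.locallyFinsuppWithin.toClosedBall_eval_within _ h]
      have har : ‖a‖ ≤ r := by simpa [habs] using h
      rw [posLog_eq_log]
      rw [abs_of_pos (by positivity), ← div_eq_mul_inv, one_le_div hn]
      exact har
    · rw [Function.locallyFinsuppWithin.apply_eq_zero_of_notMem _ h]
      have har : r < ‖a‖ := by simpa [habs] using h
      have : log⁺ (r * ‖a‖⁻¹) = 0 := by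
        rw [posLog_eq_zero_iff, abs_of_pos (by positivity), ← div_eq_mul_inv, div_le_one hn]
        exact har.le
      simp [this]
  · intro a ha
    apply hsupp a
    intro h
    simp [h] at ha

lemma countingWeight_nonneg {r : ℝ} (hr : 1 ≤ r) (a : ℂ) : 0 ≤ countingWeight r a := by
  unfold countingWeight
  split_ifs
  · exact log_nonneg hr
  · exact posLog_nonneg

lemma countingWeight_le {r : ℝ} (hr : exp 1 ≤ r) (a : ℂ) :
    countingWeight r a ≤ (1 + |log ‖a‖|) * log r := by
  have h0 : 0 < r := (exp_pos 1).trans_le hr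
  have h1 : 1 ≤ log r := by rwa [le_log_iff_exp_le h0]
  have h2 := abs_nonneg (log ‖a‖)
  unfold countingWeight
  split_ifs with ha
  · nlinarith
  · rw [posLog_apply]
    apply max_le (by positivity)
    rw [log_mul h0.ne' (by simpa using ha), log_inv]
    nlinarith [neg_abs_le (log ‖a‖)]

/-- The lower bound on `‖p‖` gives ‖p‖ ≤ (1 + η)‖p - c‖, so the shift costs at most log(1 + η) ≤ η.
The cost arises only if ‖p‖ < (1 + η) r ≤ 2r, and then the weight at radius `8 * r` is at least log
4 > 1. -/
lemma countingWeight_sub_le {r η : ℝ} {c p : ℂ} (hr : 1 ≤ r) (hη : 0 < η) (hη1 : η ≤ 1)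
    (hp : ‖c‖ * (1 + 1 / η) + 1 ≤ ‖p‖) :
    countingWeight r (p - c) ≤ countingWeight r p + η * countingWeight (8 * r) p := by
  have hc := norm_nonneg c
  have hcη : 0 ≤ ‖c‖ / η := by positivity
  have hp' : ‖c‖ + ‖c‖ / η + 1 ≤ ‖p‖ := by convert hp using 1; ring
  have hp0 : 0 < ‖p‖ := by linarith
  have hpne : p ≠ 0 := norm_pos_iff.1 hp0
  have hpc : ‖p‖ - ‖c‖ ≤ ‖p - c‖ := norm_sub_norm_le p c
  have hpc0 : 0 < ‖p - c‖ := by linarith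
  have hpcne : p - c ≠ 0 := norm_pos_iff.1 hpc0
  have h0 : 0 < r := by linarith
  simp only [countingWeight, hpne, hpcne, if_false]
  have hkey : ‖p‖ ≤ (1 + η) * ‖p - c‖ := by
    have : ‖c‖ ≤ η * (‖p‖ - ‖c‖) := by
      have := mul_le_mul_of_nonneg_left hp' hη.le
      have e : η * (‖c‖ + ‖c‖ / η + 1) = η * ‖c‖ + ‖c‖ + η := by field_simp
      nlinarith
    nlinarith
  have h1 : log⁺ (r * ‖p - c‖⁻¹) ≤ log⁺ ((1 + η) * (r * ‖p‖⁻¹)) := by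
    apply posLog_le_posLog (by positivity)
    rw [← div_eq_mul_inv, ← div_eq_mul_inv, ← mul_div_assoc, div_le_div_iff₀ hpc0 hp0]
    nlinarith
  refine h1.trans ?_
  rcases le_or_gt ((1 + η) * r) ‖p‖ with h | h
  · have : log⁺ ((1 + η) * (r * ‖p‖⁻¹)) = 0 := by
      rw [posLog_eq_zero_iff, abs_of_pos (by positivity), ← div_eq_mul_inv, ← mul_div_assoc,
        div_le_one hp0]
      exact h
    rw [this]
    have := posLog_nonneg (x := r * ‖p‖⁻¹)
    have := posLog_nonneg (x := 8 * r * ‖p‖⁻¹)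
    positivity
  · have h2 : (1 : ℝ) ≤ log⁺ (8 * r * ‖p‖⁻¹) := by
      have h4 : exp 1 ≤ 8 * r * ‖p‖⁻¹ := by
        rw [← div_eq_mul_inv, le_div_iff₀ hp0]
        have := exp_one_lt_d9
        nlinarith
      calc (1 : ℝ) ≤ log (8 * r * ‖p‖⁻¹) := by rwa [le_log_iff_exp_le (by positivity)]
        _ ≤ _ := by simp [posLog_apply]
    have h3 : log⁺ (1 + η) ≤ η := by
      rw [posLog_eq_log (by rw [abs_of_pos (by linarith)]; linarith)]
      linarith [log_le_sub_one_of_pos (by linarith : 0 < 1 + η)]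
    have h4 := posLog_mul (x := 1 + η) (y := r * ‖p‖⁻¹)
    nlinarith

/-- The counting functions of the poles of `f` and of its shift differ by little. -/
lemma exists_logCounting_shift_le {f : ℂ → ℂ} (hf : Meromorphic f) (c : ℂ) {η : ℝ} (hη : 0 < η)
    (hη1 : η ≤ 1) :
    ∃ K : ℝ, ∀ᶠ r in atTop, logCounting (fun z ↦ f (z + c)) ⊤ r ≤
      logCounting f ⊤ r + η * logCounting f ⊤ (8 * r) + K * log r := by
  classical
  have hfc : Meromorphic fun z ↦ f (z + c) := by simpa using hf
  set D : Function.locallyFinsupp ℂ ℤ := (divisor f Set.univ)⁻ with hD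
  set Dc : Function.locallyFinsupp ℂ ℤ := (divisor (fun z ↦ f (z + c)) Set.univ)⁻ with hDc
  have hD0 : ∀ a, (0 : ℝ) ≤ D a := fun a ↦ by
    exact_mod_cast (negPart_nonneg (divisor f Set.univ) : (0 : Function.locallyFinsupp ℂ ℤ) ≤ _) a
  have hshift : ∀ a, Dc a = D (a + c) := fun a ↦ by
    simp only [hD, hDc, Function.locallyFinsuppWithin.negPart_apply]
    rw [divisor_apply hf.meromorphicOn (Set.mem_univ _),
      divisor_apply hfc.meromorphicOn (Set.mem_univ _)]
    congr 2
    exact meromorphicOrderAt_comp_add_const_eq_meromorphicOrderAt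
  have hfin : ∀ ρ : ℝ, {a : ℂ | ‖a‖ ≤ ρ ∧ D a ≠ 0}.Finite := fun ρ ↦ by
    have := LocallyFiniteSupport.finite_inter_support_of_isCompact
      (Function.locallyFinsupp.locallyFiniteSupport D) (isCompact_closedBall (0 : ℂ) ρ)
    refine this.subset fun a ha ↦ ⟨by simpa using ha.1, ha.2⟩
  -- The threshold of `countingWeight_sub_le`. The finitely many poles within it are estimated
  -- crudely and produce the term `K * log r`.
  set P := ‖c‖ * (1 + 1 / η) + 1 with hP
  set S₀ := (hfin P).toFinset with hS₀
  refine ⟨∑ p ∈ S₀, (D p : ℝ) * (1 + |log ‖p - c‖|), ?_⟩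
  filter_upwards [eventually_ge_atTop 1, eventually_ge_atTop ‖c‖, eventually_ge_atTop P,
    eventually_ge_atTop (exp 1)] with r hr1 hrc hrP hre
  set s := (hfin (8 * r)).toFinset with hs
  have e1 : logCounting f ⊤ r = ∑ a ∈ s, (D a : ℝ) * countingWeight r a := by
    rw [logCounting_top]
    exact logCounting_eq_sum hr1 s fun a ha ha' ↦ by
      simp only [hs, Set.Finite.mem_toFinset]
      exact ⟨by linarith, ha'⟩
  have e2 : logCounting f ⊤ (8 * r) = ∑ a ∈ s, (D a : ℝ) * countingWeight (8 * r) a := by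
    rw [logCounting_top]
    exact logCounting_eq_sum (by linarith) s fun a ha ha' ↦ by
      simp only [hs, Set.Finite.mem_toFinset]
      exact ⟨ha, ha'⟩
  have e3 : logCounting (fun z ↦ f (z + c)) ⊤ r =
      ∑ p ∈ s, (D p : ℝ) * countingWeight r (p - c) := by
    rw [logCounting_top, logCounting_eq_sum hr1 (s.image fun p ↦ p - c),
      Finset.sum_image fun p _ q _ h ↦ by simpa using h]
    · apply Finset.sum_congr rfl
      intro p _
      rw [← hDc, hshift]; simp
    · intro a ha ha'
      rw [← hDc, hshift] at ha'
      rw [Finset.mem_image]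
      refine ⟨a + c, ?_, by ring⟩
      simp only [hs, Set.Finite.mem_toFinset]
      exact ⟨by linarith [norm_add_le a c], ha'⟩
  have hsub : S₀ ⊆ s := fun p hp ↦ by
    simp only [hS₀, hs, Set.Finite.mem_toFinset] at hp ⊢
    exact ⟨hp.1.trans (by linarith), hp.2⟩
  have e4 : (∑ p ∈ S₀, (D p : ℝ) * (1 + |log ‖p - c‖|)) * log r =
      ∑ p ∈ s, if p ∈ S₀ then (D p : ℝ) * ((1 + |log ‖p - c‖|) * log r) else 0 := by
    rw [Finset.sum_ite_mem, Finset.inter_eq_right.2 hsub, Finset.sum_mul]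
    simp_rw [mul_assoc]
  rw [e1, e2, e3, e4, Finset.mul_sum, ← Finset.sum_add_distrib, ← Finset.sum_add_distrib]
  apply Finset.sum_le_sum
  intro p hp
  have w1 := countingWeight_nonneg hr1 p
  have w2 := countingWeight_nonneg (by linarith : 1 ≤ 8 * r) p
  have hDp := hD0 p
  split_ifs with hpS
  · have := mul_le_mul_of_nonneg_left (countingWeight_le hre (p - c)) hDp
    have := mul_nonneg hDp w1
    have := mul_nonneg hη.le (mul_nonneg hDp w2)
    linarith
  · have hpP : P ≤ ‖p‖ := by
      by_contra h
      apply hpS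
      simp only [hS₀, hs, Set.Finite.mem_toFinset] at hp ⊢
      exact ⟨(not_le.1 h).le, hp.2⟩
    have := mul_le_mul_of_nonneg_left (countingWeight_sub_le hr1 hη hη1 hpP) hDp
    linarith

/-! ### Growth of functions that are not rational -/

lemma exists_mul_log_sub_le_logCounting {D : Function.locallyFinsupp ℂ ℤ} (hD : 0 ≤ D)
    (hinf : D.support.Infinite) (N : ℕ) :
    ∃ K : ℝ, ∀ᶠ r in atTop, N * log r - K ≤ Function.locallyFinsuppWithin.logCounting D r := by
  classical
  obtain ⟨t, ht, hcard⟩ := hinf.exists_subset_card_eq N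
  set D' : Function.locallyFinsupp ℂ ℤ :=
    ∑ z ∈ t, Function.locallyFinsuppWithin.single z (1 : ℤ) with hD'
  have hle : D' ≤ D := by
    intro w
    have : D' w = if w ∈ t then 1 else 0 := by
      simp only [hD', Function.locallyFinsuppWithin.coe_sum, Finset.sum_apply,
        Function.locallyFinsuppWithin.single_apply]
      simp
    rw [this]
    split_ifs with hw
    · have h1 : D w ≠ 0 := ht (Finset.mem_coe.2 hw)
      have h2 : 0 ≤ D w := hD w
      show 1 ≤ D w
      omega
    · exact hD w
  obtain ⟨R₀, hR₀⟩ : ∃ R₀ : ℝ, ∀ z ∈ t, ‖z‖ ≤ R₀ := t.finite_toSet.isBounded.exists_norm_le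
  refine ⟨∑ z ∈ t, log ‖z‖, ?_⟩
  filter_upwards [eventually_ge_atTop R₀, eventually_ge_atTop 1] with r hr hr1
  refine le_trans (le_of_eq ?_) (Function.locallyFinsuppWithin.logCounting_le hle hr1)
  rw [hD', map_sum, Finset.sum_apply, ← hcard, ← nsmul_eq_mul, ← Finset.sum_const,
    ← Finset.sum_sub_distrib]
  apply Finset.sum_congr rfl
  intro z hz
  rw [Function.locallyFinsuppWithin.logCounting_single_eq_log_sub_const ((hR₀ z hz).trans hr)]
  simp

lemma isRational_finprod (d : ℂ → ℤ) (hd : d.support.Finite) (k : ℂ) {f : ℂ → ℂ}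
    (hf : f =ᶠ[codiscrete ℂ] fun z ↦ (∏ᶠ u, (fun w ↦ w - u) ^ d u : ℂ → ℂ) z * k) :
    IsRational f := by
  classical
  refine ⟨Polynomial.C k * ∏ a ∈ hd.toFinset, (Polynomial.X - Polynomial.C a) ^ (d a).toNat,
    ∏ a ∈ hd.toFinset, (Polynomial.X - Polynomial.C a) ^ (-d a).toNat, ?_, ?_⟩
  · exact Finset.prod_ne_zero_iff.2 fun a _ ↦ pow_ne_zero _ (Polynomial.X_sub_C_ne_zero a)
  have hne : ∀ᶠ z in codiscrete ℂ, z ∉ hd.toFinset := by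
    have := compl_finite_mem_codiscreteWithin (s := Set.univ) hd
    filter_upwards [this] with z hz
    simpa using hz
  filter_upwards [hf, hne] with z hz hzs
  rw [hz, finprod_eq_prod_of_mulSupport_subset (s := hd.toFinset), Finset.prod_apply]
  · simp only [Polynomial.eval_mul, Polynomial.eval_C, Polynomial.eval_prod, Polynomial.eval_pow,
      Polynomial.eval_sub, Polynomial.eval_X]
    rw [mul_comm, mul_div_assoc, ← Finset.prod_div_distrib]
    congr 1
    apply Finset.prod_congr rfl
    intro a ha
    have hza : z - a ≠ 0 := fun h ↦ hzs (by rwa [sub_eq_zero.1 h])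
    rw [Pi.pow_apply, eq_div_iff (pow_ne_zero _ hza), ← zpow_natCast, ← zpow_natCast,
      ← zpow_add₀ hza]
    congr 1
    omega
  · intro a ha
    simp only [Set.Finite.coe_toFinset, Function.mem_support, Function.mem_mulSupport] at ha ⊢
    intro h
    exact ha (by simp [h])

lemma exists_abs_characteristic_sub_le {F : ℂ → ℂ} (hF : Meromorphic F) :
    ∃ C, 0 ≤ C ∧ ∀ r, |T F r - T F⁻¹ r| ≤ C :=
  ⟨_, (abs_nonneg _).trans (characteristic_sub_characteristic_inv_le hF (R := 0)),
    fun r ↦ characteristic_sub_characteristic_inv_le hF (R := r)⟩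

lemma proximity_le_T {F : ℂ → ℂ} {r : ℝ} (hr : 1 ≤ r) : proximity F ⊤ r ≤ T F r :=
  le_add_of_nonneg_right (logCounting_nonneg hr)

lemma logCounting_le_T {F : ℂ → ℂ} {r : ℝ} : logCounting F ⊤ r ≤ T F r :=
  le_add_of_nonneg_left (proximity_nonneg (f := F) (a := ⊤) r)

lemma T_nonneg {F : ℂ → ℂ} {r : ℝ} (hr : 1 ≤ r) : 0 ≤ T F r := characteristic_nonneg hr

/-- Any `N` points of the support already contribute N log r + O(1). A bound at arbitrarily large
radii suffices, which is all that the negation of a little-o relation provides. -/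
lemma infinite_support_contradiction {D : Function.locallyFinsupp ℂ ℤ} (hD : 0 ≤ D) {C C' : ℝ}
    (hfreq : ∃ᶠ r in atTop, Function.locallyFinsuppWithin.logCounting D r ≤ C * log r + C') :
    D.support.Finite := by
  by_contra hinf
  obtain ⟨N, hN⟩ := exists_nat_gt C
  obtain ⟨K, hK⟩ := exists_mul_log_sub_le_logCounting hD hinf N
  have hT : Tendsto (fun r ↦ ((N : ℝ) - C) * log r) atTop atTop :=
    tendsto_log_atTop.const_mul_atTop (sub_pos.mpr hN)
  obtain ⟨r, h1, h2, h3⟩ := (hfreq.and_eventually (hK.and (hT.eventually_gt_atTop (K + C')))).exists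
  linarith

/-- A meromorphic function which is not rational grows faster than `log r`. -/
lemma log_isLittleO_T {f : ℂ → ℂ} (hf : Meromorphic f) (hrat : ¬ IsRational f) :
    log =o[atTop] T f := by
  by_contra hno
  apply hrat
  by_cases htop : ∃ z, meromorphicOrderAt f z = ⊤
  · refine ⟨0, 1, one_ne_zero, ?_⟩
    have h0 : ∀ z, meromorphicOrderAt f z = ⊤ := by
      by_contra! h
      obtain ⟨z, hz⟩ := htop
      exact (hf.exists_meromorphicOrderAt_ne_top_iff_forall.1 h) z hz
    apply eventually_codiscreteWithin_of_nhdsNE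
    intro z _
    filter_upwards [meromorphicOrderAt_eq_top_iff.1 (h0 z)] with w hw
    simp [hw]
  push Not at htop
  obtain ⟨C, hC⟩ : ∃ C : ℝ, ∃ᶠ r in atTop, T f r ≤ C * log r := by
    rw [isLittleO_iff] at hno
    push Not at hno
    obtain ⟨ε, hε, h⟩ := hno
    refine ⟨ε⁻¹, (h.and_eventually (eventually_ge_atTop 1)).mono ?_⟩
    rintro r ⟨h1, h2⟩
    rw [norm_of_nonneg (T_nonneg h2), norm_of_nonneg (log_nonneg h2)] at h1
    rw [inv_mul_eq_div, le_div_iff₀ hε]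
    linarith
  obtain ⟨C', hC'0, hC'⟩ := exists_abs_characteristic_sub_le hf
  have hT' : ∀ r, T f⁻¹ r ≤ T f r + C' := fun r ↦ by linarith [(abs_le.1 (hC' r)).1]
  have hfin : (divisor f Set.univ).support.Finite := by
    have h1 : ((divisor f Set.univ)⁻ : Function.locallyFinsupp ℂ ℤ).support.Finite := by
      apply infinite_support_contradiction (negPart_nonneg _) (C := C) (C' := C')
      rw [← logCounting_top]
      exact hC.mono fun r hr ↦ by linarith [logCounting_le_T (F := f) (r := r)]
    have h2 : ((divisor f Set.univ)⁺ : Function.locallyFinsupp ℂ ℤ).support.Finite := by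
      apply infinite_support_contradiction (posPart_nonneg _) (C := C) (C' := C')
      rw [← logCounting_zero, ← logCounting_inv]
      exact hC.mono fun r hr ↦ by linarith [logCounting_le_T (F := f⁻¹) (r := r), hT' r]
    refine (h1.union h2).subset fun a ha ↦ ?_
    by_contra hcon
    simp only [Set.mem_union, Function.mem_support, not_or, not_not,
      Function.locallyFinsuppWithin.posPart_apply,
      Function.locallyFinsuppWithin.negPart_apply] at hcon ha
    rw [← posPart_sub_negPart (divisor f Set.univ a), hcon.1, hcon.2] at ha
    simp at ha
  -- What remains after removing the finitely many zeros and poles is entire and zero-free, so `log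
  -- ‖G‖` is harmonic on the plane. Its oscillation is O(log r / r) along a sequence of radii, so
  -- `‖G‖` is constant, and `G` is constant by Liouville's theorem.
  obtain ⟨G, hG, hG0, hfG⟩ := (hf.meromorphicOn (s := Set.univ)).extract_zeros_poles
    (fun u ↦ htop u) hfin
  set d := divisor f Set.univ with hd
  have hlog := extract_zeros_poles_log hG0 hfG
  have hlog' : ∀ᶠ z in codiscrete ℂ,
      log ‖f z‖ = ∑ a ∈ hfin.toFinset, (d a : ℝ) * log ‖z - a‖ + log ‖G z‖ := by
    filter_upwards [hlog] with z hz
    rw [hz, Pi.add_apply, finsum_eq_sum_of_support_subset (s := hfin.toFinset), Finset.sum_apply]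
    intro a ha
    simp only [Set.Finite.coe_toFinset, Function.mem_support] at ha ⊢
    intro h
    apply ha
    rw [h]; simp; rfl
  have hu : ∀ x, HarmonicAt (fun z ↦ log ‖G z‖) x := fun x ↦
    (hG x trivial).harmonicAt_log_norm (hG0 ⟨x, trivial⟩)
  obtain ⟨R₀, hR₀⟩ : ∃ R₀ : ℝ, ∀ z ∈ hfin.toFinset, ‖z‖ ≤ R₀ :=
    (Finset.finite_toSet _).isBounded.exists_norm_le
  set n := ∑ a ∈ hfin.toFinset, |(d a : ℝ)| with hn
  have hn0 : 0 ≤ n := Finset.sum_nonneg fun _ _ ↦ abs_nonneg _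
  have hconst : ∀ w w', log ‖G w‖ = log ‖G w'‖ := by
    intro w w'
    have hbound : ∃ᶠ r in atTop, |log ‖G w‖ - log ‖G w'‖| ≤
        8 * ‖w - w'‖ * (2 * C + C' + 4 * n) * (log r / r) := by
      refine (hC.and_eventually ((eventually_ge_atTop (exp 1)).and ((eventually_ge_atTop 2).and
        ((eventually_ge_atTop R₀).and ((eventually_ge_atTop (2 * ‖w‖)).and
        (eventually_ge_atTop (2 * ‖w'‖))))))).mono ?_
      rintro r ⟨h1, h2, h3, h4, h5, h6⟩
      have hr : 0 < r := by linarith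
      have hlr : 1 ≤ log r := by rwa [le_log_iff_exp_le hr]
      have g := abs_sub_le_of_harmonicOnNhd hr (u := fun z ↦ log ‖G z‖) (fun x _ ↦ hu x)
        (w := w) (w' := w') (by linarith) (by linarith)
      have hav := circleAverage_abs_le_of_log_norm_eq hf (R := r) (n := n) (by linarith)
        (s := hfin.toFinset) (fun a ha ↦ (hR₀ a ha).trans h4) (d := fun a ↦ (d a : ℝ)) le_rfl
        (u := fun z ↦ log ‖G z‖) (fun x _ ↦ (hu x).1.continuousAt.continuousWithinAt)
        (codiscreteWithin_mono (Set.subset_univ _) hlog')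
      rw [circleAverage_abs_log_norm hf] at hav
      have p1 := proximity_le_T (F := f) (r := r) (by linarith)
      have p2 := proximity_le_T (F := f⁻¹) (r := r) (by linarith)
      have p3 := hT' r
      have hl2 : log (2 * r) ≤ 2 * log r := by
        rw [log_mul (by norm_num) hr.ne']
        have := log_le_log (by norm_num) h3
        linarith
      have hn2 : n * (2 * log (2 * r)) ≤ 4 * n * log r := by nlinarith
      have hav' : circleAverage (fun z ↦ |log ‖G z‖|) 0 r ≤ (2 * C + C' + 4 * n) * log r := by
        nlinarith
      refine g.trans ?_
      calc 8 * ‖w - w'‖ / r * circleAverage (fun z ↦ |log ‖G z‖|) 0 r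
          ≤ 8 * ‖w - w'‖ / r * ((2 * C + C' + 4 * n) * log r) := by gcongr
        _ = _ := by ring
    have hlim : Tendsto (fun r ↦ 8 * ‖w - w'‖ * (2 * C + C' + 4 * n) * (log r / r)) atTop (𝓝 0) := by
      have := isLittleO_log_id_atTop.tendsto_div_nhds_zero.const_mul
        (8 * ‖w - w'‖ * (2 * C + C' + 4 * n))
      simpa using this
    by_contra hne
    have hpos : 0 < |log ‖G w‖ - log ‖G w'‖| := abs_pos.2 (sub_ne_zero.2 hne)
    obtain ⟨r, h1, h2⟩ := (hbound.and_eventually (hlim.eventually (gt_mem_nhds hpos))).exists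
    exact absurd h1 (not_le.2 h2)
  have hGd : Differentiable ℂ G := fun z ↦ (hG z trivial).differentiableAt
  have hGb : Bornology.IsBounded (Set.range G) := by
    rw [isBounded_iff_forall_norm_le]
    refine ⟨‖G 0‖, ?_⟩
    rintro _ ⟨z, rfl⟩
    have p1 : 0 < ‖G z‖ := norm_pos_iff.2 (hG0 ⟨z, trivial⟩)
    have p2 : 0 < ‖G 0‖ := norm_pos_iff.2 (hG0 ⟨0, trivial⟩)
    exact (log_injOn_pos p1 p2 (hconst z 0)).le
  apply isRational_finprod d hfin (G 0)
  filter_upwards [hfG] with z hz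
  rw [hz, Pi.smul_apply', smul_eq_mul, hGd.apply_eq_apply_of_bounded hGb z 0]

/-! ### Finite order and the choice of radii -/

lemma eventually_T_le_pow {f : ℂ → ℂ} (hfin : HasFiniteOrder f) :
    ∃ σ : ℕ, ∀ᶠ r in atTop, T f r ≤ r ^ σ := by
  obtain ⟨b, hb1, hb2⟩ := exists_between hfin
  obtain ⟨x, hx1, hx2⟩ := EReal.lt_iff_exists_real_btwn.1 hb2
  obtain ⟨σ, hσ⟩ := exists_nat_ge x
  refine ⟨σ, ?_⟩
  filter_upwards [eventually_lt_of_limsup_lt hb1, eventually_gt_atTop 1] with r hr hr1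
  have h1 : log⁺ (T f r) / log r < x := by
    exact_mod_cast hr.trans hx1
  have hl : 0 < log r := log_pos hr1
  rw [div_lt_iff₀ hl] at h1
  have h2 : log⁺ (T f r) ≤ σ * log r := h1.le.trans (by gcongr)
  rcases le_or_gt (T f r) 0 with h | h
  · exact h.trans (by positivity)
  · have : log (T f r) ≤ log (r ^ σ) := by
      rw [log_pow]
      exact le_trans (by simp [posLog_apply]) h2
    exact (log_le_log_iff h (by positivity)).1 this

/-- A set of finite logarithmic measure omits points in all intervals `[16 ^ n, 2 * 16 ^ n]`, for
large `n`. -/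
lemma eventually_exists_notMem {E : Set ℝ}
    (hfin : ∫⁻ r in E, ENNReal.ofReal r⁻¹ < ⊤) :
    ∀ᶠ n : ℕ in atTop, ∃ x ∈ Set.Icc ((16 : ℝ) ^ n) (2 * 16 ^ n), x ∉ E := by
  set I : ℕ → Set ℝ := fun n ↦ Set.Icc ((16 : ℝ) ^ n) (2 * 16 ^ n) with hI
  -- The disjoint intervals have summable `ν`-masses, so these tend to zero. An interval contained
  -- in `E` would have mass at least 16^n / (2 · 16^n) = 1/2.
  set ν := (volume.restrict E).withDensity fun r ↦ ENNReal.ofReal r⁻¹ with hν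
  have hdisj : Pairwise (Function.onFun Disjoint I) := by
    have aux : ∀ m n : ℕ, m < n → Disjoint (I m) (I n) := fun m n hmn ↦ by
      rw [Set.disjoint_left]
      rintro x ⟨_, h1⟩ ⟨h2, _⟩
      have h3 : (16 : ℝ) ^ (m + 1) ≤ 16 ^ n := pow_le_pow_right₀ (by norm_num) hmn
      have h4 : (0 : ℝ) < 16 ^ m := by positivity
      rw [pow_succ] at h3
      linarith
    intro m n hmn
    rcases lt_or_gt_of_ne hmn with h | h
    · exact aux m n h
    · exact (aux n m h).symm
  have hsum : ∑' n, ν (I n) ≠ ⊤ := by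
    rw [← measure_iUnion hdisj fun n ↦ measurableSet_Icc]
    refine ne_top_of_le_ne_top hfin.ne ((measure_mono (Set.subset_univ _)).trans ?_)
    rw [hν, withDensity_apply _ MeasurableSet.univ, Measure.restrict_univ]
  have hlim := ENNReal.tendsto_atTop_zero_of_tsum_ne_top hsum
  filter_upwards [hlim.eventually (gt_mem_nhds (show (0 : ENNReal) < ENNReal.ofReal (1 / 2) by
    simp))] with n hn
  by_contra! hcon
  have hpos : (0 : ℝ) < 16 ^ n := by positivity
  apply absurd hn
  rw [not_lt, hν, withDensity_apply _ measurableSet_Icc, Measure.restrict_restrict measurableSet_Icc,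
    Set.inter_eq_left.2 hcon]
  calc ENNReal.ofReal (1 / 2)
      = ENNReal.ofReal (2 * 16 ^ n)⁻¹ * volume (I n) := by
        rw [hI, Real.volume_Icc, ← ENNReal.ofReal_mul (by positivity)]
        congr 1
        field_simp
        norm_num
    _ = ∫⁻ _ in I n, ENNReal.ofReal (2 * 16 ^ n)⁻¹ := by rw [setLIntegral_const]
    _ ≤ ∫⁻ r in I n, ENNReal.ofReal r⁻¹ := by
        apply setLIntegral_mono' measurableSet_Icc
        intro x hx
        apply ENNReal.ofReal_le_ofReal
        have : 0 < x := hpos.trans_le hx.1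
        gcongr
        exact hx.2

/-- Sequences of radii along which `T f` does not grow too fast, outside of a set of finite
logarithmic measure. -/
lemma exists_radii {τ : ℝ → ℝ} {σ : ℕ} (hσ : ∀ᶠ r in atTop, τ r ≤ r ^ σ) (hτ : ∀ᶠ r in atTop, 1 ≤ τ r) {E : Set ℝ}
    (hfin : ∫⁻ r in E, ENNReal.ofReal r⁻¹ < ⊤) :
    ∃ (C : ℝ) (r R : ℕ → ℝ), Tendsto r atTop atTop ∧ (∀ n, 8 * r n ≤ R n) ∧ (∀ n, 1 ≤ r n) ∧
      (∀ n, r n ∉ E) ∧ (∀ n, R n ∉ E) ∧ ∀ n, τ (R n) ≤ C * τ (r n) := by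
  have hpow : Tendsto (fun n : ℕ ↦ (16 : ℝ) ^ n) atTop atTop :=
    tendsto_pow_atTop_atTop_of_one_lt (by norm_num)
  have hσ' := hpow.eventually (eventually_forall_ge_atTop.2 hσ)
  have hτ' := hpow.eventually (eventually_forall_ge_atTop.2 hτ)
  obtain ⟨N, hN⟩ := eventually_atTop.1 ((eventually_exists_notMem hfin).and (hσ'.and hτ'))
  choose x hxI hxE using fun n : ℕ ↦ (hN (n + N) (by omega)).1
  have hxσ : ∀ n, τ (x n) ≤ x n ^ σ := fun n ↦ (hN (n + N) (by omega)).2.1 _ (hxI n).1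
  have hxτ : ∀ n, 1 ≤ τ (x n) := fun n ↦ (hN (n + N) (by omega)).2.2 _ (hxI n).1
  have hx0 : ∀ n, 1 ≤ x n := fun n ↦ (one_le_pow₀ (by norm_num)).trans (hxI n).1
  have hx8 : ∀ n, 8 * x n ≤ x (n + 1) := fun n ↦ by
    have h1 := (hxI n).2
    have h2 := (hxI (n + 1)).1
    rw [show n + 1 + N = n + N + 1 by ring, pow_succ] at h2
    linarith
  -- Otherwise `τ (x n)` eventually grows by a factor above 16^(σ + 1) at each step, whereas `τ r ≤
  -- r ^ σ` permits only growth of order 16^(σ n).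
  have hfreq : ∃ᶠ n in atTop, τ (x (n + 1)) ≤ 16 ^ (σ + 1) * τ (x n) := by
    intro hcon
    obtain ⟨m, hm⟩ := eventually_atTop.1 hcon
    have hgrow : ∀ k : ℕ, ((16 : ℝ) ^ (σ + 1)) ^ k ≤ τ (x (m + k)) := by
      intro k
      induction k with
      | zero => simpa using hxτ m
      | succ k ih =>
        have h1 := hm (m + k) (by omega)
        rw [not_le] at h1
        rw [pow_succ, mul_comm]
        refine le_trans ?_ h1.le
        gcongr
    have hup : ∀ k : ℕ, τ (x (m + k)) ≤ (2 * 16 ^ (m + N)) ^ σ * ((16 : ℝ) ^ σ) ^ k := by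
      intro k
      refine (hxσ _).trans ?_
      have h0 := hx0 (m + k)
      calc x (m + k) ^ σ ≤ (2 * 16 ^ (m + k + N)) ^ σ := by
            gcongr
            exact (hxI _).2
        _ = (2 * 16 ^ (m + N)) ^ σ * ((16 : ℝ) ^ σ) ^ k := by
            rw [← pow_mul, mul_comm σ k, pow_mul, ← mul_pow]
            congr 1
            ring
    obtain ⟨k, hk⟩ := (hpow.eventually_gt_atTop ((2 * 16 ^ (m + N)) ^ σ)).exists
    have h3 := (hgrow k).trans (hup k)
    rw [pow_succ, mul_pow, mul_comm] at h3
    have h4 : (0 : ℝ) < ((16 : ℝ) ^ σ) ^ k := by positivity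
    exact absurd (le_of_mul_le_mul_right h3 h4) (not_le.2 hk)
  obtain ⟨φ, hφ, hφ'⟩ := extraction_of_frequently_atTop hfreq
  refine ⟨16 ^ (σ + 1), fun n ↦ x (φ n), fun n ↦ x (φ n + 1), ?_, fun n ↦ hx8 _, fun n ↦ hx0 _,
    fun n ↦ hxE _, fun n ↦ hxE _, hφ'⟩
  have hxt : Tendsto x atTop atTop :=
    tendsto_atTop_mono (fun n ↦ (hxI n).1) (hpow.comp (tendsto_add_atTop_nat N))
  exact hxt.comp hφ.tendsto_atTop

/-! ### Functions of small proximity along the radii -/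

/-- Radii `r n < R n` along which `T f` grows moderately, but faster than the logarithm. -/
structure GoodRadii (f : ℂ → ℂ) (r R : ℕ → ℝ) (C : ℝ) : Prop where
  tendsto : Tendsto r atTop atTop
  le : ∀ n, 8 * r n ≤ R n
  one_le : ∀ n, 1 ≤ r n
  T_le : ∀ n, T f (R n) ≤ C * T f (r n)
  log_small : (fun n ↦ log (r n)) =o[atTop] fun n ↦ T f (r n)

/-- The proximity function of `g` is small along the radii `r n`. -/
def SmallProx (f : ℂ → ℂ) (r : ℕ → ℝ) (g : ℂ → ℂ) : Prop :=
  Meromorphic g ∧ (fun n ↦ proximity g ⊤ (r n)) =o[atTop] fun n ↦ T f (r n)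

lemma isLittleO_of_le_of_nonneg {φ ψ τ : ℕ → ℝ} (h0 : ∀ n, 0 ≤ φ n) (h : ∀ n, φ n ≤ ψ n)
    (hψ : ψ =o[atTop] τ) : φ =o[atTop] τ :=
  (isBigO_of_le atTop fun n ↦ by
    rw [norm_of_nonneg (h0 n), norm_of_nonneg ((h0 n).trans (h n))]; exact h n).trans_isLittleO hψ

section Radii

variable {f : ℂ → ℂ} {r R : ℕ → ℝ} {C : ℝ}

lemma GoodRadii.const_small (h : GoodRadii f r R C) (k : ℝ) :
    (fun _ : ℕ ↦ k) =o[atTop] fun n ↦ T f (r n) := by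
  refine IsLittleO.trans_isBigO (g := fun n ↦ log (r n)) ?_ h.log_small.isBigO
  exact isLittleO_const_left.2 (Or.inr (tendsto_norm_atTop_atTop.comp
    (tendsto_log_atTop.comp h.tendsto)))

lemma proximity_nonneg' (g : ℂ → ℂ) (ρ : ℝ) : 0 ≤ proximity g ⊤ ρ := proximity_nonneg (a := ⊤) ρ

lemma SmallProx.mul {g₁ g₂ : ℂ → ℂ} (h₁ : SmallProx f r g₁) (h₂ : SmallProx f r g₂) :
    SmallProx f r (g₁ * g₂) :=
  ⟨h₁.1.mul h₂.1, isLittleO_of_le_of_nonneg (fun _ ↦ proximity_nonneg' _ _)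
    (fun n ↦ proximity_mul_top_le h₁.1 h₂.1 (r n)) (h₁.2.add h₂.2)⟩

lemma SmallProx.add (h : GoodRadii f r R C) {g₁ g₂ : ℂ → ℂ} (h₁ : SmallProx f r g₁)
    (h₂ : SmallProx f r g₂) : SmallProx f r (g₁ + g₂) :=
  ⟨h₁.1.add h₂.1, isLittleO_of_le_of_nonneg (fun _ ↦ proximity_nonneg' _ _)
    (fun n ↦ proximity_add_top_le h₁.1 h₂.1 (r n)) ((h₁.2.add h₂.2).add (h.const_small _))⟩

lemma SmallProx.neg {g : ℂ → ℂ} (h : SmallProx f r g) : SmallProx f r (-g) :=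
  ⟨h.1.neg, by simpa [proximity_top] using h.2⟩

lemma SmallProx.sub (h : GoodRadii f r R C) {g₁ g₂ : ℂ → ℂ} (h₁ : SmallProx f r g₁)
    (h₂ : SmallProx f r g₂) : SmallProx f r (g₁ - g₂) := by
  rw [sub_eq_add_neg]; exact h₁.add h h₂.neg

lemma SmallProx.congr (h : GoodRadii f r R C) {g₁ g₂ : ℂ → ℂ} (h₁ : SmallProx f r g₁)
    (h₂ : Meromorphic g₂) (he : g₂ =ᶠ[codiscrete ℂ] g₁) : SmallProx f r g₂ :=
  ⟨h₂, h₁.2.congr_left fun n ↦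
    (proximity_congr_codiscrete he (by linarith [h.one_le n] : r n ≠ 0)).symm⟩

lemma T_neg {g : ℂ → ℂ} (hg : Meromorphic g) : T (-g) = T g := by
  ext ρ
  have h1 : proximity (-g) ⊤ = proximity g ⊤ := by simp [proximity_top]
  have h2 : divisor (-g) Set.univ = divisor g Set.univ := by
    ext z
    rw [divisor_apply hg.meromorphicOn (Set.mem_univ z),
      divisor_apply hg.neg.meromorphicOn (Set.mem_univ z), ← meromorphicOrderAt_neg]
  simp only [T, characteristic, Pi.add_apply, h1, logCounting_top, h2]

lemma T_sub_le {g₁ g₂ : ℂ → ℂ} (h₁ : Meromorphic g₁) (h₂ : Meromorphic g₂) {ρ : ℝ} (hρ : 1 ≤ ρ) :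
    T (g₁ - g₂) ρ ≤ T g₁ ρ + T g₂ ρ + log 2 := by
  have := characteristic_add_top_le h₁ h₂.neg hρ
  rw [← sub_eq_add_neg] at this
  rw [← T_neg h₂]
  exact this

/-- A periodic function which is small along the radii `r n` and `R n`. -/
structure SmallTarget (f : ℂ → ℂ) (c : ℂ) (r R : ℕ → ℝ) (a : ℂ → ℂ) : Prop where
  mero : Meromorphic a
  periodic : IsPeriodic a c
  small : (fun n ↦ T a (r n)) =o[atTop] fun n ↦ T f (r n)
  small' : (fun n ↦ T a (R n)) =o[atTop] fun n ↦ T f (R n)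

lemma SmallTarget.smallProx {c : ℂ} {a : ℂ → ℂ} (h : GoodRadii f r R C)
    (ha : SmallTarget f c r R a) : SmallProx f r a :=
  ⟨ha.mero, isLittleO_of_le_of_nonneg (fun _ ↦ proximity_nonneg' _ _)
    (fun n ↦ proximity_le_T (h.one_le n)) ha.small⟩

/-- The difference operator. -/
def shiftDiff (f : ℂ → ℂ) (c : ℂ) : ℂ → ℂ := (fun z ↦ f (z + c)) - f

lemma meromorphic_shift (hf : Meromorphic f) (c : ℂ) : Meromorphic fun z ↦ f (z + c) := by
  simpa using hf

lemma meromorphic_shiftDiff (hf : Meromorphic f) (c : ℂ) : Meromorphic (shiftDiff f c) :=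
  (meromorphic_shift hf c).sub hf

lemma eventually_codiscrete_ne_zero {g : ℂ → ℂ} (hg : Meromorphic g)
    (hg' : ∀ z, meromorphicOrderAt g z ≠ ⊤) : ∀ᶠ z in codiscrete ℂ, g z ≠ 0 :=
  eventually_codiscreteWithin_of_nhdsNE fun z _ ↦
    (meromorphicOrderAt_ne_top_iff_eventually_ne_zero (hg z)).1 (hg' z)

lemma GoodRadii.R_one_le (h : GoodRadii f r R C) (n : ℕ) : 1 ≤ R n := by
  linarith [h.le n, h.one_le n]

lemma GoodRadii.isBigO_T_R (h : GoodRadii f r R C) :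
    (fun n ↦ T f (R n)) =O[atTop] fun n ↦ T f (r n) :=
  IsBigO.of_bound C (Eventually.of_forall fun n ↦ by
    rw [norm_of_nonneg (T_nonneg (h.R_one_le n)), norm_of_nonneg (T_nonneg (h.one_le n))]
    exact h.T_le n)

/-- Periodicity of `a` turns the quotient into (f - a)(z + c)/(f - a)(z) - 1. The bound from
`exists_proximity_shift_div_le` involves T(R_n, f - a), which is O(T(r_n, f)) by the choice of radii
and the smallness of `a` at `R n`. -/
lemma SmallTarget.smallProx_shiftDiff_div {c : ℂ} {a : ℂ → ℂ} (h : GoodRadii f r R C)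
    (hf : Meromorphic f) (ha : SmallTarget f c r R a)
    (hfa : ∀ z, meromorphicOrderAt (f - a) z ≠ ⊤) :
    SmallProx f r (shiftDiff f c * (f - a)⁻¹) := by
  have hFm : Meromorphic (f - a) := hf.sub ha.mero
  set Q : ℂ → ℂ := fun z ↦ (f - a) (z + c) / (f - a) z with hQ
  have hQm : Meromorphic Q := (meromorphic_shift hFm c).div hFm
  have hQs : SmallProx f r Q := by
    refine ⟨hQm, ?_⟩
    obtain ⟨δ, hδ, hb⟩ := exists_proximity_shift_div_le hFm hfa c
    have hδ' : (fun n ↦ δ (r n)) =o[atTop] fun _ ↦ (1 : ℝ) :=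
      (isLittleO_one_iff ℝ).2 (hδ.comp h.tendsto)
    have hT : (fun n ↦ T (f - a) (R n) + 1) =O[atTop] fun n ↦ T f (r n) := by
      have h1 : (fun n ↦ T (f - a) (R n)) =O[atTop]
          fun n ↦ T f (R n) + T a (R n) + log 2 := isBigO_of_le _ fun n ↦ by
        have h2 := T_sub_le hf ha.mero (h.R_one_le n)
        have h3 := T_nonneg (F := f - a) (h.R_one_le n)
        rw [norm_of_nonneg h3, norm_of_nonneg (h3.trans h2)]
        exact h2
      refine IsBigO.add (h1.trans ?_) (h.const_small 1).isBigO
      exact (h.isBigO_T_R.add (ha.small'.isBigO.trans h.isBigO_T_R)).add (h.const_small _).isBigO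
    have := hδ'.mul_isBigO hT
    simp only [one_mul] at this
    refine IsBigO.trans_isLittleO (IsBigO.of_bound 1 ?_) this
    filter_upwards [h.tendsto.eventually hb] with n hn
    have h1 := hn (R n) (h.le n)
    rw [norm_of_nonneg (proximity_nonneg' _ _), one_mul]
    exact h1.trans (le_norm_self _)
  have h1 : SmallProx f r (fun _ ↦ (1 : ℂ)) :=
    ⟨fun z ↦ MeromorphicAt.const 1 z, by simp [proximity_const]⟩
  refine (hQs.sub h h1).congr h ((meromorphic_shiftDiff hf c).mul hFm.inv) ?_
  filter_upwards [eventually_codiscrete_ne_zero hFm hfa, ha.periodic] with z hz hp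
  simp only [Pi.mul_apply, Pi.inv_apply, Pi.sub_apply, shiftDiff, hQ] at hz ⊢
  rw [hp]
  field_simp
  ring

/-- By the first main theorem. These reciprocals are the coefficients in the partial fractions of W.
-/
lemma SmallTarget.smallProx_sub_inv {c : ℂ} {a b : ℂ → ℂ} (h : GoodRadii f r R C)
    (ha : SmallTarget f c r R a) (hb : SmallTarget f c r R b) :
    SmallProx f r (a - b)⁻¹ := by
  have hm := ha.mero.sub hb.mero
  obtain ⟨C', _, hC'⟩ := exists_abs_characteristic_sub_le hm
  refine ⟨hm.inv, isLittleO_of_le_of_nonneg (fun _ ↦ proximity_nonneg' _ _) (fun n ↦ ?_)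
    (((ha.small.add hb.small).add (h.const_small (log 2))).add (h.const_small C'))⟩
  have h1 := T_sub_le ha.mero hb.mero (h.one_le n)
  have h2 := (abs_le.1 (hC' (r n))).1
  have h3 := proximity_le_T (F := (a - b)⁻¹) (h.one_le n)
  linarith

lemma SmallTarget.logCounting_pole_small {c : ℂ} {a : ℂ → ℂ} (h : GoodRadii f r R C)
    (ha : SmallTarget f c r R a) :
    (fun n ↦ Function.locallyFinsuppWithin.logCounting (divisor a Set.univ)⁻ (r n)) =o[atTop]
      fun n ↦ T f (r n) := by
  simp_rw [← logCounting_top]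
  exact isLittleO_of_le_of_nonneg (fun n ↦ logCounting_nonneg (h.one_le n))
    (fun n ↦ logCounting_le_T) ha.small

lemma SmallTarget.logCounting_sub_small {c : ℂ} {a b : ℂ → ℂ} (h : GoodRadii f r R C)
    (ha : SmallTarget f c r R a) (hb : SmallTarget f c r R b) :
    (fun n ↦ Function.locallyFinsuppWithin.logCounting (divisor (a - b) Set.univ)⁺ (r n)) =o[atTop]
      fun n ↦ T f (r n) := by
  have hm := ha.mero.sub hb.mero
  obtain ⟨C', _, hC'⟩ := exists_abs_characteristic_sub_le hm
  simp_rw [← logCounting_zero, ← logCounting_inv]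
  refine isLittleO_of_le_of_nonneg (fun n ↦ logCounting_nonneg (h.one_le n)) (fun n ↦ ?_)
    (((ha.small.add hb.small).add (h.const_small (log 2))).add (h.const_small C'))
  have h1 := T_sub_le ha.mero hb.mero (h.one_le n)
  have h2 := (abs_le.1 (hC' (r n))).1
  have h3 := logCounting_le_T (F := (a - b)⁻¹) (r := r n)
  linarith

/-! ### The contradiction from Jensen's formula -/

/-- The main estimate: there is no meromorphic `W` of small proximity with few zeros and poles
compared to those of `f` and its shift. -/
lemma GoodRadii.false_of_divisor_le {c : ℂ} (h : GoodRadii f r R C) (hf : Meromorphic f)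
    {W : ℂ → ℂ} (hW : SmallProx f r W) (hWf : SmallProx f r (W * f))
    (hW' : ∀ z, meromorphicOrderAt W z ≠ ⊤) {B : Function.locallyFinsupp ℂ ℤ}
    (hB : (fun n ↦ Function.locallyFinsuppWithin.logCounting B (r n)) =o[atTop]
      fun n ↦ T f (r n)) {S : Set ℂ} (hS : S.Finite)
    (hdiv : ∀ z ∉ S, 2 * (divisor f Set.univ z)⁻ - (divisor (fun w ↦ f (w + c)) Set.univ z)⁻ - B z
      ≤ divisor W Set.univ z) : False := by
  classical
  set P : Function.locallyFinsupp ℂ ℤ := (divisor f Set.univ)⁻ with hP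
  set Pc : Function.locallyFinsupp ℂ ℤ := (divisor (fun w ↦ f (w + c)) Set.univ)⁻ with hPc
  set dW : Function.locallyFinsupp ℂ ℤ := divisor W Set.univ with hdW
  -- A correction on the finite set `S` makes the divisor inequality hold everywhere, at a cost of
  -- O(log r).
  set X : ℂ → ℤ := fun z ↦ |2 * P z - Pc z - B z - dW z| with hX
  set E : Function.locallyFinsupp ℂ ℤ :=
    ∑ z ∈ hS.toFinset, Function.locallyFinsuppWithin.single z (X z) with hE
  have hEz : ∀ z, E z = if z ∈ hS.toFinset then X z else 0 := fun z ↦ by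
    simp only [hE, Function.locallyFinsuppWithin.coe_sum, Finset.sum_apply,
      Function.locallyFinsuppWithin.single_apply]
    simp
  have hle : P + P - Pc - B - E ≤ dW := by
    intro z
    show P z + P z - Pc z - B z - E z ≤ dW z
    rw [hEz]
    split_ifs with hz
    · simp only [hX]
      have := le_abs_self (2 * P z - Pc z - B z - dW z)
      omega
    · have := hdiv z (by simpa using hz)
      simp only [hP, hPc, Function.locallyFinsuppWithin.negPart_apply]
      omega
  have hEO : (fun n ↦ Function.locallyFinsuppWithin.logCounting E (r n)) =o[atTop]
      fun n ↦ T f (r n) := by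
    have hfin : E.support.Finite := hS.subset fun z hz ↦ by
      by_contra hcon
      simp [hEz, hcon] at hz
    exact ((Function.locallyFinsuppWithin.logCounting_isBigO_log_of_finite_support
      hfin).comp_tendsto h.tendsto).trans_isLittleO h.log_small
  -- Jensen's formula
  set k := log ‖meromorphicTrailingCoeffAt W 0‖ with hk
  have hJ : ∀ n, 2 * logCounting f ⊤ (r n) + proximity f ⊤ (r n) ≤
      logCounting (fun w ↦ f (w + c)) ⊤ (r n) +
      ((Function.locallyFinsuppWithin.logCounting B (r n) +
        Function.locallyFinsuppWithin.logCounting E (r n)) +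
        (proximity W ⊤ (r n) + proximity (W * f) ⊤ (r n)) + -k) := fun n ↦ by
    have hr1 := h.one_le n
    have hr0 : r n ≠ 0 := by linarith
    have h1 := Function.locallyFinsuppWithin.logCounting_le hle hr1
    simp only [map_sub, map_add, Pi.sub_apply, Pi.add_apply] at h1
    rw [hdW, Function.locallyFinsuppWithin.logCounting_divisor_eq_circleAverage_sub_const hW.1 hr0,
      hP, hPc, ← logCounting_top, ← logCounting_top] at h1
    have i1 : CircleIntegrable (fun z ↦ log ‖W z‖) 0 (r n) :=
      MeromorphicOn.circleIntegrable_log_norm fun _ _ ↦ hW.1 _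
    have i2 : CircleIntegrable (fun z ↦ log⁺ ‖f z‖) 0 (r n) :=
      MeromorphicOn.circleIntegrable_posLog_norm fun _ _ ↦ hf _
    have i3 : CircleIntegrable (fun z ↦ log⁺ ‖W z‖) 0 (r n) :=
      MeromorphicOn.circleIntegrable_posLog_norm fun _ _ ↦ hW.1 _
    have i4 : CircleIntegrable (fun z ↦ log⁺ ‖(W * f) z‖) 0 (r n) :=
      MeromorphicOn.circleIntegrable_posLog_norm fun _ _ ↦ hWf.1 _
    -- Pointwise, log|W| + log⁺|f| is log|W| where |f| ≤ 1 and log|W f| where |f| > 1.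
    have h2 : circleAverage (fun z ↦ log ‖W z‖) 0 (r n) + proximity f ⊤ (r n) ≤
        proximity W ⊤ (r n) + proximity (W * f) ⊤ (r n) := by
      rw [proximity_top, proximity_top, proximity_top, ← circleAverage_fun_add i1 i2,
        ← circleAverage_fun_add i3 i4]
      apply circleAverage_mono_codiscreteWithin hr0 (i1.add i2) (i3.add i4)
      filter_upwards [codiscreteWithin_mono (Set.subset_univ _)
        (eventually_codiscrete_ne_zero hW.1 hW')] with z hz
      simp only [Pi.add_apply]
      have p1 : log ‖W z‖ ≤ log⁺ ‖W z‖ := by simp [posLog_apply]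
      have p2 := posLog_nonneg (x := ‖(W * f) z‖)
      rcases le_or_gt ‖f z‖ 1 with hf1 | hf1
      · have : log⁺ ‖f z‖ = 0 := by rwa [posLog_eq_zero_iff, abs_norm]
        linarith
      · have e1 : log⁺ ‖f z‖ = log ‖f z‖ := posLog_eq_log (by rw [abs_norm]; exact hf1.le)
        have e2 : log ‖(W * f) z‖ = log ‖W z‖ + log ‖f z‖ := by
          rw [Pi.mul_apply, norm_mul, log_mul (by simpa using hz) (by linarith)]
        have p3 : log ‖(W * f) z‖ ≤ log⁺ ‖(W * f) z‖ := by simp [posLog_apply]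
        have p4 := posLog_nonneg (x := ‖W z‖)
        linarith
    linarith
  have hsmall := (((hB.add hEO).add (hW.2.add hWf.2)).add (h.const_small (-k)))
  -- Chosen so that η N(8 r_n, f) ≤ T(r_n, f)/4, as N(8 r_n, f) ≤ |C| T(r_n, f). The other errors
  -- also take at most a quarter, leaving T ≤ T/2 although T ≥ 1.
  set η : ℝ := min 1 (1 / (4 * (|C| + 1))) with hη
  have hη0 : 0 < η := lt_min one_pos (by positivity)
  obtain ⟨K, hK⟩ := exists_logCounting_shift_le hf c hη0 (min_le_left _ _)
  have hsmall' := hsmall.add (h.log_small.const_mul_left K)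
  have hT1 : ∀ᶠ n in atTop, 1 ≤ T f (r n) := by
    filter_upwards [(h.const_small 1).bound one_pos] with n hn
    rw [norm_of_nonneg (T_nonneg (h.one_le n))] at hn
    simpa using hn
  obtain ⟨n, h1, h2, h3⟩ := ((h.tendsto.eventually hK).and (hT1.and
    (hsmall'.bound (show (0 : ℝ) < 1 / 4 by norm_num)))).exists
  rw [norm_of_nonneg (T_nonneg (h.one_le n))] at h3
  have h4 := (le_norm_self _).trans h3
  have h5 := hJ n
  have h6 : T f (r n) = proximity f ⊤ (r n) + logCounting f ⊤ (r n) := rfl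
  have h7 : logCounting f ⊤ (8 * r n) ≤ |C| * T f (r n) := by
    have a1 : logCounting f ⊤ (8 * r n) ≤ logCounting f ⊤ (R n) := by
      have := h.one_le n
      have := h.le n
      apply logCounting_monotoneOn _ _ this
      · simp only [Set.mem_Ioi]; linarith
      · simp only [Set.mem_Ioi]; linarith
    refine a1.trans (logCounting_le_T.trans ((h.T_le n).trans ?_))
    exact mul_le_mul_of_nonneg_right (le_abs_self C) (by linarith)
  have h8 : η * logCounting f ⊤ (8 * r n) ≤ 1 / 4 * T f (r n) := by
    calc η * logCounting f ⊤ (8 * r n) ≤ 1 / (4 * (|C| + 1)) * (|C| * T f (r n)) := by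
          apply mul_le_mul (min_le_right _ _) h7 (logCounting_nonneg (by linarith [h.one_le n]))
            (by positivity)
      _ = |C| / (|C| + 1) * (1 / 4 * T f (r n)) := by field_simp
      _ ≤ 1 * (1 / 4 * T f (r n)) := by
          gcongr
          rw [div_le_one (by positivity)]; linarith
      _ = _ := one_mul _
  linarith

end Radii

/-! ### Local orders of zeros and poles at paired points -/

lemma eventually_nhdsNE_of_codiscrete {p : ℂ → Prop} (h : ∀ᶠ z in codiscrete ℂ, p z) (z : ℂ) :
    ∀ᶠ w in 𝓝[≠] z, p w := by
  filter_upwards [mem_codiscreteWithin_iff_forall_mem_nhdsNE.1 h z (Set.mem_univ _)] with w hw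
  simpa using hw

lemma eventually_codiscrete_shift {p : ℂ → Prop} (h : ∀ᶠ z in codiscrete ℂ, p z) (c : ℂ) :
    ∀ᶠ z in codiscrete ℂ, p (z + c) :=
  eventually_codiscreteWithin_of_nhdsNE fun z _ ↦ eventually_nhdsNE_comp_add
    (eventually_nhdsNE_of_codiscrete h (z + c))

lemma IsPeriodic.congr {f g : ℂ → ℂ} {c : ℂ} (hg : IsPeriodic g c) (h : MeroEq f g) :
    IsPeriodic f c := by
  filter_upwards [hg, h, eventually_codiscrete_shift h c] with z h1 h2 h3
  rw [h3, h1, h2]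

lemma isPeriodic_const (k c : ℂ) : IsPeriodic (fun _ ↦ k) c := EventuallyEq.rfl

/-- A meromorphic function which is of infinite order at one point vanishes identically. -/
lemma meroEq_zero_of_order_eq_top {g : ℂ → ℂ} (hg : Meromorphic g) {z : ℂ}
    (hz : meromorphicOrderAt g z = ⊤) : MeroEq g 0 := by
  have h : ∀ u, meromorphicOrderAt g u = ⊤ := by
    by_contra! hcon
    exact (hg.exists_meromorphicOrderAt_ne_top_iff_forall.1 hcon) z hz
  exact eventually_codiscreteWithin_of_nhdsNE fun u _ ↦ by
    simpa using meromorphicOrderAt_eq_top_iff.1 (h u)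

lemma meroEq_of_sub_order_eq_top {f g : ℂ → ℂ} (hf : Meromorphic f) (hg : Meromorphic g) {z : ℂ}
    (hz : meromorphicOrderAt (f - g) z = ⊤) : MeroEq f g := by
  filter_upwards [meroEq_zero_of_order_eq_top (hf.sub hg) hz] with w hw
  simpa [sub_eq_zero] using hw

lemma meromorphicOrderAt_mul_ne_top {g h : ℂ → ℂ} (hg : Meromorphic g) (hh : Meromorphic h)
    (hg' : ∀ z, meromorphicOrderAt g z ≠ ⊤) (hh' : ∀ z, meromorphicOrderAt h z ≠ ⊤) (z : ℂ) :
    meromorphicOrderAt (g * h) z ≠ ⊤ := by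
  rw [meromorphicOrderAt_mul (hg z) (hh z)]
  simp [hg' z, hh' z]

lemma meromorphicOrderAt_inv_ne_top {g : ℂ → ℂ} (hg' : ∀ z, meromorphicOrderAt g z ≠ ⊤) (z : ℂ) :
    meromorphicOrderAt g⁻¹ z ≠ ⊤ := by
  rw [meromorphicOrderAt_inv]
  intro h
  apply hg' z
  have := congrArg (fun x ↦ -x) h
  simpa using this

lemma divisor_mul_inv_apply {g h : ℂ → ℂ} (hg : Meromorphic g) (hh : Meromorphic h)
    (hg' : ∀ z, meromorphicOrderAt g z ≠ ⊤) (hh' : ∀ z, meromorphicOrderAt h z ≠ ⊤) (z : ℂ) :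
    divisor (g * h⁻¹) Set.univ z = divisor g Set.univ z - divisor h Set.univ z := by
  rw [divisor_mul hg.meromorphicOn hh.inv.meromorphicOn (fun z _ ↦ hg' z)
    (fun z _ ↦ meromorphicOrderAt_inv_ne_top hh' z), divisor_inv]
  simp [sub_eq_add_neg]

lemma negPart_divisor_le_max_sub {f a : ℂ → ℂ} (hf : Meromorphic f) (ha : Meromorphic a) (z : ℂ) :
    (divisor f Set.univ z)⁻ ≤ max (divisor (f - a) Set.univ z)⁻ (divisor a Set.univ z)⁻ := by
  have := negPart_divisor_add_le_max (hf.sub ha).meromorphicOn ha.meromorphicOn (U := Set.univ) z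
  simpa using this

lemma divisor_eq_untop {g : ℂ → ℂ} (hg : Meromorphic g) (z : ℂ) :
    divisor g Set.univ z = (meromorphicOrderAt g z).untop₀ :=
  divisor_apply hg.meromorphicOn (Set.mem_univ z)

lemma divisor_neg_apply {g : ℂ → ℂ} (hg : Meromorphic g) (z : ℂ) :
    divisor (-g) Set.univ z = divisor g Set.univ z := by
  rw [divisor_eq_untop hg, divisor_eq_untop hg.neg, ← meromorphicOrderAt_neg]

lemma negPart_divisor_shiftDiff_le {f : ℂ → ℂ} (hf : Meromorphic f) (c z : ℂ) :
    (divisor (shiftDiff f c) Set.univ z)⁻ ≤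
      max (divisor (fun w ↦ f (w + c)) Set.univ z)⁻ (divisor f Set.univ z)⁻ := by
  have := negPart_divisor_add_le_max (meromorphic_shift hf c).meromorphicOn hf.neg.meromorphicOn
    (U := Set.univ) z
  rw [← sub_eq_add_neg] at this
  have h2 := divisor_neg_apply hf z
  simpa [shiftDiff, h2] using this

/-- From a - b = (f - b) - (f - a): `f - a` and `f - b` vanish together only at zeros of `a - b`,
which are few. -/
lemma min_divisor_sub_le {f a b : ℂ → ℂ} (hf : Meromorphic f) (ha : Meromorphic a)
    (hb : Meromorphic b) (hab : ∀ z, meromorphicOrderAt (a - b) z ≠ ⊤) (z : ℂ) :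
    min (divisor (f - a) Set.univ z) (divisor (f - b) Set.univ z) ≤
      (divisor (a - b) Set.univ z)⁺ := by
  have e : a - b = (f - b) + -(f - a) := by ring
  have h2 := divisor_neg_apply (hf.sub ha) z
  have := min_divisor_le_divisor_add (hf.sub hb).meromorphicOn (hf.sub ha).neg.meromorphicOn
    (Set.mem_univ z) (e ▸ hab z)
  rw [← e, h2, min_comm] at this
  exact this.trans (le_posPart _)

lemma divisor_shift_apply {g : ℂ → ℂ} (hg : Meromorphic g) (c z : ℂ) :
    divisor (fun w ↦ g (w + c)) Set.univ z = divisor g Set.univ (z + c) := by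
  rw [divisor_eq_untop (meromorphic_shift hg c), divisor_eq_untop hg]
  congr 1
  exact meromorphicOrderAt_comp_add_const_eq_meromorphicOrderAt

lemma IsExceptionalPaired.negPart_divisor_le {f : ℂ → ℂ} {c : ℂ} (hf : Meromorphic f)
    (h : IsExceptionalPaired f c .infty) : ∃ S : Set ℂ, S.Finite ∧ ∀ z ∉ S,
      (divisor f Set.univ z)⁻ ≤ (divisor (fun w ↦ f (w + c)) Set.univ z)⁻ := by
  refine ⟨_, h, fun z hz ↦ ?_⟩
  rw [divisor_shift_apply hf, divisor_eq_untop hf, divisor_eq_untop hf]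
  simp only [pointMultiplicity, Set.mem_ofPred_eq, not_and, not_not, Nat.cast_pos,
    Nat.cast_le] at hz
  simp only [negPart_def]
  omega

/-- By periodicity of `a`, Δf is the difference of `(f - a)(w + c)` and `(f - a)(w)`. At a paired
point both terms vanish to at least the order of `f - a` at `z`. -/
lemma IsExceptionalPaired.divisor_sub_le {f a : ℂ → ℂ} {c : ℂ} (hf : Meromorphic f)
    (ha : Meromorphic a) (hac : IsPeriodic a c) (hfa : ∀ z, meromorphicOrderAt (f - a) z ≠ ⊤)
    (hD : ∀ z, meromorphicOrderAt (shiftDiff f c) z ≠ ⊤) (h : IsExceptionalPaired f c (.fn a)) :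
    ∃ S : Set ℂ, S.Finite ∧ ∀ z ∉ S, 0 < divisor (f - a) Set.univ z →
      divisor (f - a) Set.univ z ≤ divisor (shiftDiff f c) Set.univ z := by
  refine ⟨_, h, fun z hz hpos ↦ ?_⟩
  have hF := hf.sub ha
  have hz' : 0 < (meromorphicOrderAt (f - a) z).untop₀ →
      (meromorphicOrderAt (f - a) z).untop₀ ≤ (meromorphicOrderAt (f - a) (z + c)).untop₀ := by
    have e : (fun w ↦ f w - a w) = f - a := rfl
    simp only [pointMultiplicity, Set.mem_ofPred_eq, not_and, not_not, e, hfa, if_false,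
      Nat.cast_pos, Nat.cast_le] at hz
    omega
  rw [← divisor_eq_untop hF, ← divisor_eq_untop hF, ← divisor_shift_apply hF] at hz'
  have he : shiftDiff f c =ᶠ[codiscreteWithin Set.univ]
      (fun w ↦ (f - a) (w + c)) + -(f - a) := by
    filter_upwards [hac] with w hw
    simp [shiftDiff, hw]
  have h2 := divisor_neg_apply (hf.sub ha) z
  have ho : meromorphicOrderAt ((fun w ↦ (f - a) (w + c)) + -(f - a)) z ≠ ⊤ := by
    rw [← meromorphicOrderAt_congr (eventually_nhdsNE_of_codiscrete he z)]
    exact hD z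
  have := min_divisor_le_divisor_add (meromorphic_shift hF c).meromorphicOn hF.neg.meromorphicOn
    (Set.mem_univ z) ho
  rw [← divisor_congr_codiscreteWithin he isOpen_univ, h2, min_eq_right (hz' hpos)] at this
  exact this

/-! ### The two configurations of targets -/

section Cases

variable {f : ℂ → ℂ} {r R : ℕ → ℝ} {C : ℝ} {c : ℂ}

/-- Here W = Δf/((f - a)(f - b)). Away from poles of the targets, a pole of `f` of order p, with
order q at the shifted point, gives W order at least 2p - max(p, q), which is 2p - q because ∞ is
paired. -/
lemma false_of_infty_of_two (h : GoodRadii f r R C) (hf : Meromorphic f) {a b : ℂ → ℂ}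
    (ha : SmallTarget f c r R a) (hb : SmallTarget f c r R b)
    (hD : ∀ z, meromorphicOrderAt (shiftDiff f c) z ≠ ⊤)
    (hfa : ∀ z, meromorphicOrderAt (f - a) z ≠ ⊤) (hfb : ∀ z, meromorphicOrderAt (f - b) z ≠ ⊤)
    (hab : ∀ z, meromorphicOrderAt (a - b) z ≠ ⊤)
    (e : IsExceptionalPaired f c .infty) (ea : IsExceptionalPaired f c (.fn a))
    (eb : IsExceptionalPaired f c (.fn b)) : False := by
  have hDm := meromorphic_shiftDiff hf c
  have hfam := hf.sub ha.mero
  have hfbm := hf.sub hb.mero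
  have h1 := ha.smallProx_shiftDiff_div h hf hfa
  have h2 := hb.smallProx_shiftDiff_div h hf hfb
  have hi := ha.smallProx_sub_inv h hb
  have hPm := hfam.mul hfbm
  have hP' := meromorphicOrderAt_mul_ne_top hfam hfbm hfa hfb
  have hne := (eventually_codiscrete_ne_zero hfam hfa).and
    ((eventually_codiscrete_ne_zero hfbm hfb).and
    (eventually_codiscrete_ne_zero (ha.mero.sub hb.mero) hab))
  have hWm : Meromorphic (shiftDiff f c * ((f - a) * (f - b))⁻¹) := hDm.mul hPm.inv
  have hW : SmallProx f r (shiftDiff f c * ((f - a) * (f - b))⁻¹) := by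
    refine (hi.mul (h1.sub h h2)).congr h hWm ?_
    filter_upwards [hne] with z hz
    simp only [Pi.mul_apply, Pi.inv_apply, Pi.sub_apply] at hz ⊢
    obtain ⟨z1, z2, z3⟩ := hz
    field_simp
    ring
  -- Partial fractions: f/((f - a)(f - b)) = (a/(f - a) - b/(f - b))/(a - b).
  have hWf : SmallProx f r (shiftDiff f c * ((f - a) * (f - b))⁻¹ * f) := by
    refine (hi.mul (((ha.smallProx h).mul h1).sub h ((hb.smallProx h).mul h2))).congr h
      (hWm.mul hf) ?_
    filter_upwards [hne] with z hz
    simp only [Pi.mul_apply, Pi.inv_apply, Pi.sub_apply] at hz ⊢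
    obtain ⟨z1, z2, z3⟩ := hz
    field_simp
    ring
  obtain ⟨S, hS, hSe⟩ := e.negPart_divisor_le hf
  obtain ⟨S₁, hS₁, hSe₁⟩ := ea.divisor_sub_le hf ha.mero ha.periodic hfa hD
  obtain ⟨S₂, hS₂, hSe₂⟩ := eb.divisor_sub_le hf hb.mero hb.periodic hfb hD
  have p1 := ha.logCounting_pole_small h
  have p2 := hb.logCounting_pole_small h
  refine h.false_of_divisor_le (c := c) hf hW hWf
    (meromorphicOrderAt_mul_ne_top hDm hPm.inv hD (meromorphicOrderAt_inv_ne_top hP'))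
    (B := (divisor a Set.univ)⁻ + (divisor a Set.univ)⁻ +
      ((divisor b Set.univ)⁻ + (divisor b Set.univ)⁻) + (divisor (a - b) Set.univ)⁺) ?_
    (hS.union (hS₁.union hS₂)) fun z hz ↦ ?_
  · simp only [map_add, Pi.add_apply]
    exact ((p1.add p1).add (p2.add p2)).add (ha.logCounting_sub_small h hb)
  · simp only [Set.mem_union, not_or] at hz
    rw [divisor_mul_inv_apply hDm hPm hD hP', divisor_mul hfam.meromorphicOn hfbm.meromorphicOn
      (fun z _ ↦ hfa z) (fun z _ ↦ hfb z)]
    simp only [Function.locallyFinsuppWithin.coe_add, Pi.add_apply,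
      Function.locallyFinsuppWithin.negPart_apply, Function.locallyFinsuppWithin.posPart_apply]
    have q0 := hSe z hz.1
    have q1 := hSe₁ z hz.2.1
    have q2 := hSe₂ z hz.2.2
    have q3 := negPart_divisor_le_max_sub hf ha.mero z
    have q4 := negPart_divisor_le_max_sub hf hb.mero z
    have q5 := negPart_divisor_shiftDiff_le hf c z
    have q6 := min_divisor_sub_le hf ha.mero hb.mero hab z
    simp only [negPart_def, posPart_def] at *
    omega

/-- The local order of W at one point: `p`, `q` are the pole orders of `f` and its shift, `D` and
`A₁, A₂, A₃` the orders of Δf and of `f` minus each target, `P₁, P₂, P₃` and `B₁, B₂, B₃` the pole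
orders of the targets and the zero orders of their differences. At a pole of `f` alone, 3p - max(p,
q) ≥ 2p - q, so the third factor replaces the pairing of poles. Elsewhere `D` absorbs one positive
`Aᵢ` and the `Bᵢ` absorb the others. -/
lemma int_le_of_three {p q D A₁ A₂ A₃ P₁ P₂ P₃ B₁ B₂ B₃ : ℤ} (hq : 0 ≤ q) (hP₁ : 0 ≤ P₁)
    (hP₂ : 0 ≤ P₂) (hP₃ : 0 ≤ P₃) (hB₁ : 0 ≤ B₁) (hB₂ : 0 ≤ B₂) (hB₃ : 0 ≤ B₃)
    (h₁ : 0 < A₁ → A₁ ≤ D) (h₂ : 0 < A₂ → A₂ ≤ D) (h₃ : 0 < A₃ → A₃ ≤ D)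
    (m₁ : p ≤ max A₁⁻ P₁) (m₂ : p ≤ max A₂⁻ P₂) (m₃ : p ≤ max A₃⁻ P₃) (hD : D⁻ ≤ max q p)
    (l₁ : min A₁ A₂ ≤ B₁) (l₂ : min A₁ A₃ ≤ B₂) (l₃ : min A₂ A₃ ≤ B₃) :
    2 * p - q - (2 * P₁ + 2 * P₂ + 2 * P₃ + (B₁ + B₂ + B₃)) ≤ D - (A₁ + A₂ + A₃) := by
  have ex (A : ℤ) : 0 < A ∧ A⁻ = 0 ∨ A ≤ 0 ∧ A⁻ = -A := by
    rcases lt_or_ge 0 A with h | h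
    · exact Or.inl ⟨h, negPart_of_nonneg h.le⟩
    · exact Or.inr ⟨h, negPart_of_nonpos h⟩
  rcases ex A₁ with ⟨a₁, e₁⟩ | ⟨a₁, e₁⟩ <;> rcases ex A₂ with ⟨a₂, e₂⟩ | ⟨a₂, e₂⟩ <;>
    rcases ex A₃ with ⟨a₃, e₃⟩ | ⟨a₃, e₃⟩ <;> rcases ex D with ⟨a₄, e₄⟩ | ⟨a₄, e₄⟩ <;>
    rw [e₁] at m₁ <;> rw [e₂] at m₂ <;> rw [e₃] at m₃ <;> rw [e₄] at hD <;> grind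

lemma false_of_three (h : GoodRadii f r R C) (hf : Meromorphic f) {a b d : ℂ → ℂ}
    (ha : SmallTarget f c r R a) (hb : SmallTarget f c r R b) (hd : SmallTarget f c r R d)
    (hD : ∀ z, meromorphicOrderAt (shiftDiff f c) z ≠ ⊤)
    (hfa : ∀ z, meromorphicOrderAt (f - a) z ≠ ⊤) (hfb : ∀ z, meromorphicOrderAt (f - b) z ≠ ⊤)
    (hfd : ∀ z, meromorphicOrderAt (f - d) z ≠ ⊤)
    (hab : ∀ z, meromorphicOrderAt (a - b) z ≠ ⊤) (had : ∀ z, meromorphicOrderAt (a - d) z ≠ ⊤)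
    (hbd : ∀ z, meromorphicOrderAt (b - d) z ≠ ⊤)
    (ea : IsExceptionalPaired f c (.fn a)) (eb : IsExceptionalPaired f c (.fn b))
    (ed : IsExceptionalPaired f c (.fn d)) : False := by
  have hDm := meromorphic_shiftDiff hf c
  have hfam := hf.sub ha.mero
  have hfbm := hf.sub hb.mero
  have hfdm := hf.sub hd.mero
  have h1 := ha.smallProx_shiftDiff_div h hf hfa
  have h2 := hb.smallProx_shiftDiff_div h hf hfb
  have h3 := hd.smallProx_shiftDiff_div h hf hfd
  have iab := ha.smallProx_sub_inv h hb
  have iad := ha.smallProx_sub_inv h hd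
  have ibd := hb.smallProx_sub_inv h hd
  have hQm := hfam.mul hfbm
  have hQ' := meromorphicOrderAt_mul_ne_top hfam hfbm hfa hfb
  have hPm := hQm.mul hfdm
  have hP' := meromorphicOrderAt_mul_ne_top hQm hfdm hQ' hfd
  have hne := ((eventually_codiscrete_ne_zero hfam hfa).and
    ((eventually_codiscrete_ne_zero hfbm hfb).and (eventually_codiscrete_ne_zero hfdm hfd))).and
    ((eventually_codiscrete_ne_zero (ha.mero.sub hb.mero) hab).and
    ((eventually_codiscrete_ne_zero (ha.mero.sub hd.mero) had).and
    (eventually_codiscrete_ne_zero (hb.mero.sub hd.mero) hbd)))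
  have hWm : Meromorphic (shiftDiff f c * ((f - a) * (f - b) * (f - d))⁻¹) := hDm.mul hPm.inv
  have hW : SmallProx f r (shiftDiff f c * ((f - a) * (f - b) * (f - d))⁻¹) := by
    -- Partial fractions in `f` with poles at `a`, `b`, `d`; for W·f each term is multiplied by its
    -- target.
    refine ((((iab.mul iad).mul h1).sub h ((iab.mul ibd).mul h2)).add h
      ((iad.mul ibd).mul h3)).congr h hWm ?_
    filter_upwards [hne] with z hz
    simp only [Pi.add_apply, Pi.mul_apply, Pi.inv_apply, Pi.sub_apply] at hz ⊢
    obtain ⟨⟨z1, z2, z3⟩, z4, z5, z6⟩ := hz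
    field_simp
    ring
  have hWf : SmallProx f r (shiftDiff f c * ((f - a) * (f - b) * (f - d))⁻¹ * f) := by
    refine ((((ha.smallProx h).mul ((iab.mul iad).mul h1)).sub h
      ((hb.smallProx h).mul ((iab.mul ibd).mul h2))).add h
      ((hd.smallProx h).mul ((iad.mul ibd).mul h3))).congr h (hWm.mul hf) ?_
    filter_upwards [hne] with z hz
    simp only [Pi.add_apply, Pi.mul_apply, Pi.inv_apply, Pi.sub_apply] at hz ⊢
    obtain ⟨⟨z1, z2, z3⟩, z4, z5, z6⟩ := hz
    field_simp
    ring
  obtain ⟨S₁, hS₁, hSe₁⟩ := ea.divisor_sub_le hf ha.mero ha.periodic hfa hD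
  obtain ⟨S₂, hS₂, hSe₂⟩ := eb.divisor_sub_le hf hb.mero hb.periodic hfb hD
  obtain ⟨S₃, hS₃, hSe₃⟩ := ed.divisor_sub_le hf hd.mero hd.periodic hfd hD
  have p1 := ha.logCounting_pole_small h
  have p2 := hb.logCounting_pole_small h
  have p3 := hd.logCounting_pole_small h
  refine h.false_of_divisor_le (c := c) hf hW hWf
    (meromorphicOrderAt_mul_ne_top hDm hPm.inv hD (meromorphicOrderAt_inv_ne_top hP'))
    (B := (divisor a Set.univ)⁻ + (divisor a Set.univ)⁻ +
      ((divisor b Set.univ)⁻ + (divisor b Set.univ)⁻) +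
      ((divisor d Set.univ)⁻ + (divisor d Set.univ)⁻) + ((divisor (a - b) Set.univ)⁺ +
      (divisor (a - d) Set.univ)⁺ + (divisor (b - d) Set.univ)⁺)) ?_
    (hS₁.union (hS₂.union hS₃)) fun z hz ↦ ?_
  · simp only [map_add, Pi.add_apply]
    exact (((p1.add p1).add (p2.add p2)).add (p3.add p3)).add
      (((ha.logCounting_sub_small h hb).add (ha.logCounting_sub_small h hd)).add
        (hb.logCounting_sub_small h hd))
  · simp only [Set.mem_union, not_or] at hz
    rw [divisor_mul_inv_apply hDm hPm hD hP', divisor_mul hQm.meromorphicOn hfdm.meromorphicOn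
      (fun z _ ↦ hQ' z) (fun z _ ↦ hfd z), divisor_mul hfam.meromorphicOn hfbm.meromorphicOn
      (fun z _ ↦ hfa z) (fun z _ ↦ hfb z)]
    simp only [Function.locallyFinsuppWithin.coe_add, Pi.add_apply,
      Function.locallyFinsuppWithin.negPart_apply, Function.locallyFinsuppWithin.posPart_apply]
    have q1 := hSe₁ z hz.1
    have q2 := hSe₂ z hz.2.1
    have q3 := hSe₃ z hz.2.2
    have q4 := negPart_divisor_le_max_sub hf ha.mero z
    have q5 := negPart_divisor_le_max_sub hf hb.mero z
    have q6 := negPart_divisor_le_max_sub hf hd.mero z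
    have q7 := negPart_divisor_shiftDiff_le hf c z
    have q8 := min_divisor_sub_le hf ha.mero hb.mero hab z
    have q9 := min_divisor_sub_le hf ha.mero hd.mero had z
    have q10 := min_divisor_sub_le hf hb.mero hd.mero hbd z
    have := int_le_of_three (negPart_nonneg _) (negPart_nonneg _) (negPart_nonneg _)
      (negPart_nonneg _) (posPart_nonneg _) (posPart_nonneg _) (posPart_nonneg _)
      q1 q2 q3 q4 q5 q6 q7 q8 q9 q10
    linarith

end Cases

/-! ### Admissible targets and conclusion -/

lemma T_const (k : ℂ) (r : ℝ) : T (fun _ ↦ k) r = log⁺ ‖k‖ := by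
  simp [T, characteristic, proximity_const]

lemma tendsto_T_atTop {f : ℂ → ℂ} (h : log =o[atTop] T f) : Tendsto (T f) atTop atTop := by
  refine tendsto_atTop_mono' atTop ?_ tendsto_log_atTop
  filter_upwards [h.bound one_pos, eventually_ge_atTop 1] with r hr h1
  rw [one_mul, norm_of_nonneg (log_nonneg h1), norm_of_nonneg (T_nonneg h1)] at hr
  exact hr

/-- Constants count as small functions because T(r, f) tends to infinity, so both kinds of finite
target are treated alike. -/
lemma Target.IsAdmissible.fn {f g : ℂ → ℂ} {c : ℂ} (hlog : log =o[atTop] T f)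
    (h : Target.IsAdmissible f c (.fn g)) : Meromorphic g ∧ IsPeriodic g c ∧ IsSmall g f := by
  rcases h with ⟨k, rfl⟩ | h
  · refine ⟨fun z ↦ MeromorphicAt.const k z, isPeriodic_const k c, ∅, MeasurableSet.empty,
      Set.empty_subset _, by simp, ?_⟩
    have : T (fun _ : ℂ ↦ k) = fun _ ↦ log⁺ ‖k‖ := funext fun r ↦ T_const k r
    rw [this, Set.compl_empty, principal_univ, inf_top_eq]
    exact isLittleO_const_left.2 (Or.inr (tendsto_norm_atTop_atTop.comp (tendsto_T_atTop hlog)))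
  · exact h

/-- Radii avoiding an exceptional set of finite logarithmic measure. -/
lemma exists_goodRadii {f : ℂ → ℂ} (hfin : HasFiniteOrder f) (hlog : log =o[atTop] T f)
    {E : Set ℝ} (hE : ∫⁻ r in E, ENNReal.ofReal r⁻¹ < ⊤) :
    ∃ (C : ℝ) (r R : ℕ → ℝ), GoodRadii f r R C ∧ (∀ n, r n ∉ E) ∧ ∀ n, R n ∉ E := by
  obtain ⟨σ, hσ⟩ := eventually_T_le_pow hfin
  obtain ⟨C, r, R, h1, h2, h3, h4, h5, h6⟩ := exists_radii hσ
    ((tendsto_T_atTop hlog).eventually_ge_atTop 1) hE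
  exact ⟨C, r, R, ⟨h1, h2, h3, h6, hlog.comp_tendsto h1⟩, h4, h5⟩

lemma GoodRadii.smallTarget {f a : ℂ → ℂ} {r R : ℕ → ℝ} {C : ℝ} {c : ℂ}
    (h : GoodRadii f r R C) (ha : Meromorphic a) (hac : IsPeriodic a c) {E E' : Set ℝ}
    (hs : (T a) =o[atTop ⊓ 𝓟 Eᶜ] (T f)) (hE : E ⊆ E') (hr : ∀ n, r n ∉ E') (hR : ∀ n, R n ∉ E') :
    SmallTarget f c r R a := by
  have hRt : Tendsto R atTop atTop := tendsto_atTop_mono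
    (fun n ↦ by linarith [h.le n, h.one_le n]) h.tendsto
  refine ⟨ha, hac, hs.comp_tendsto (tendsto_inf.2 ⟨h.tendsto, ?_⟩),
    hs.comp_tendsto (tendsto_inf.2 ⟨hRt, ?_⟩)⟩
  · exact tendsto_principal.2 (Eventually.of_forall fun n hn ↦ hr n (hE hn))
  · exact tendsto_principal.2 (Eventually.of_forall fun n hn ↦ hR n (hE hn))

lemma IsConst.isPeriodic {f : ℂ → ℂ} (h : IsConst f) (c : ℂ) : IsPeriodic f c := by
  obtain ⟨k, hk⟩ := h
  exact (isPeriodic_const k c).congr hk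

lemma shiftDiff_order_ne_top {f : ℂ → ℂ} {c : ℂ} (hf : Meromorphic f) (h : ¬ IsPeriodic f c)
    (z : ℂ) : meromorphicOrderAt (shiftDiff f c) z ≠ ⊤ := fun hz ↦
  h (meroEq_of_sub_order_eq_top (meromorphic_shift hf c) hf hz)

lemma sub_order_ne_top_of_not_isPeriodic {f a : ℂ → ℂ} {c : ℂ} (hf : Meromorphic f)
    (ha : Meromorphic a) (hac : IsPeriodic a c) (h : ¬ IsPeriodic f c) (z : ℂ) :
    meromorphicOrderAt (f - a) z ≠ ⊤ := fun hz ↦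
  h (hac.congr (meroEq_of_sub_order_eq_top hf ha hz))

lemma isPeriodic_of_infty_of_two {f : ℂ → ℂ} {c : ℂ} (hf : Meromorphic f)
    (hfin : HasFiniteOrder f) (hlog : log =o[atTop] T f) {a b : ℂ → ℂ}
    (ha : Target.IsAdmissible f c (.fn a)) (hb : Target.IsAdmissible f c (.fn b))
    (hab : ¬ MeroEq a b) (e : IsExceptionalPaired f c .infty)
    (ea : IsExceptionalPaired f c (.fn a)) (eb : IsExceptionalPaired f c (.fn b)) :
    IsPeriodic f c := by
  by_contra hcon
  obtain ⟨ma, pa, E₁, -, -, f₁, s₁⟩ := ha.fn hlog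
  obtain ⟨mb, pb, E₂, -, -, f₂, s₂⟩ := hb.fn hlog
  obtain ⟨C, r, R, h, hr, hR⟩ := exists_goodRadii hfin hlog
    ((lintegral_union_le _ E₁ E₂).trans_lt (ENNReal.add_lt_top.2 ⟨f₁, f₂⟩))
  exact false_of_infty_of_two h hf
    (h.smallTarget ma pa s₁ Set.subset_union_left hr hR)
    (h.smallTarget mb pb s₂ Set.subset_union_right hr hR)
    (shiftDiff_order_ne_top hf hcon) (sub_order_ne_top_of_not_isPeriodic hf ma pa hcon)
    (sub_order_ne_top_of_not_isPeriodic hf mb pb hcon)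
    (fun _ hz ↦ hab (meroEq_of_sub_order_eq_top ma mb hz)) e ea eb

lemma isPeriodic_of_three {f : ℂ → ℂ} {c : ℂ} (hf : Meromorphic f)
    (hfin : HasFiniteOrder f) (hlog : log =o[atTop] T f) {a b d : ℂ → ℂ}
    (ha : Target.IsAdmissible f c (.fn a)) (hb : Target.IsAdmissible f c (.fn b))
    (hd : Target.IsAdmissible f c (.fn d))
    (hab : ¬ MeroEq a b) (had : ¬ MeroEq a d) (hbd : ¬ MeroEq b d)
    (ea : IsExceptionalPaired f c (.fn a)) (eb : IsExceptionalPaired f c (.fn b))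
    (ed : IsExceptionalPaired f c (.fn d)) : IsPeriodic f c := by
  by_contra hcon
  obtain ⟨ma, pa, E₁, -, -, f₁, s₁⟩ := ha.fn hlog
  obtain ⟨mb, pb, E₂, -, -, f₂, s₂⟩ := hb.fn hlog
  obtain ⟨md, pd, E₃, -, -, f₃, s₃⟩ := hd.fn hlog
  obtain ⟨C, r, R, h, hr, hR⟩ := exists_goodRadii hfin hlog (E := E₁ ∪ (E₂ ∪ E₃))
    ((lintegral_union_le _ _ _).trans_lt (ENNReal.add_lt_top.2 ⟨f₁,
      (lintegral_union_le _ _ _).trans_lt (ENNReal.add_lt_top.2 ⟨f₂, f₃⟩)⟩))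
  exact false_of_three h hf
    (h.smallTarget ma pa s₁ Set.subset_union_left hr hR)
    (h.smallTarget mb pb s₂ (Set.subset_union_left.trans Set.subset_union_right) hr hR)
    (h.smallTarget md pd s₃ (Set.subset_union_right.trans Set.subset_union_right) hr hR)
    (shiftDiff_order_ne_top hf hcon) (sub_order_ne_top_of_not_isPeriodic hf ma pa hcon)
    (sub_order_ne_top_of_not_isPeriodic hf mb pb hcon)
    (sub_order_ne_top_of_not_isPeriodic hf md pd hcon)
    (fun _ hz ↦ hab (meroEq_of_sub_order_eq_top ma mb hz))
    (fun _ hz ↦ had (meroEq_of_sub_order_eq_top ma md hz))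
    (fun _ hz ↦ hbd (meroEq_of_sub_order_eq_top mb md hz)) ea eb ed

end PairedValue

end

theorem mainTheorem5 (f : ℂ → ℂ) (c : ℂ) (hf : Meromorphic f)
    (hfin : PairedValue.HasFiniteOrder f)
    (hrat : ¬ PairedValue.IsRational f ∨ PairedValue.IsConst f)
    (a₁ a₂ a₃ : PairedValue.Target)
    (h₁ : a₁.IsAdmissible f c) (h₂ : a₂.IsAdmissible f c) (h₃ : a₃.IsAdmissible f c)
    (h₁₂ : ¬ a₁.Same a₂) (h₁₃ : ¬ a₁.Same a₃) (h₂₃ : ¬ a₂.Same a₃)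
    (he₁ : PairedValue.IsExceptionalPaired f c a₁)
    (he₂ : PairedValue.IsExceptionalPaired f c a₂)
    (he₃ : PairedValue.IsExceptionalPaired f c a₃) :
    PairedValue.IsPeriodic f c := by
  rcases hrat with hrat | hconst
  · have hlog := PairedValue.log_isLittleO_T hf hrat
    -- Distinct targets include ∞ at most once.
    match a₁, a₂, a₃ with
    | .infty, .infty, _ => exact absurd trivial h₁₂
    | .infty, .fn _, .infty => exact absurd trivial h₁₃
    | .fn _, .infty, .infty => exact absurd trivial h₂₃
    | .infty, .fn a, .fn b =>
      exact PairedValue.isPeriodic_of_infty_of_two hf hfin hlog h₂ h₃ h₂₃ he₁ he₂ he₃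
    | .fn a, .infty, .fn b =>
      exact PairedValue.isPeriodic_of_infty_of_two hf hfin hlog h₁ h₃ h₁₃ he₂ he₁ he₃
    | .fn a, .fn b, .infty =>
      exact PairedValue.isPeriodic_of_infty_of_two hf hfin hlog h₁ h₂ h₁₂ he₃ he₁ he₂
    | .fn a, .fn b, .fn d =>
      exact PairedValue.isPeriodic_of_three hf hfin hlog h₁ h₂ h₃ h₁₂ h₁₃ h₂₃ he₁ he₂ he₃
  · exact hconst.isPeriodic c
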